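/- Let $\kappa$ be a regular infinite cardinal, $\lambda\ge\kappa$ a cardinal, $\theta$ a cardinal with $2\le\theta\le\kappa$, and $\delta$ an ordinal with $1\le\delta\le\lambda$. Put $\bar\theta=\nu$ if $\theta=\kappa=\nu^+$ for a cardinal $\nu$, and $\bar\theta=\theta$ otherwise. For a cardinal $\tau$ and a set $A$ let $P_\tau(A)=\{a\subseteq A:|a|<\tau\}$. Let $I_{\kappa,\lambda}$ be the collection of all $B\subseteq P_\kappa(\lambda)$ such that, for some $a\in P_\kappa(\lambda)$, no $b\in B$ satisfies $a\subseteq b$. An ideal on $P_\kappa(\lambda)$ is a collection $K$ of subsets of $P_\kappa(\lambda)$ that is closed under subsets and under unions of nonempty subfamilies of size $<\kappa$, contains $I_{\kappa,\lambda}$, and does not contain $P_\kappa(\lambda)$. Put $K^+=P(P_\kappa(\lambda))\setminus K$, $K^*=\{B\subseteq P_\kappa(\lambda):P_\kappa(\lambda)\setminus B\in K\}$ and, for $A\in K^+$, $K|A=\{B\subseteq P_\kappa(\lambda):B\cap A\in K\}$. Let $\nabla^{[\delta]^{<\theta}}K$ be the collection of all $B\subseteq P_\kappa(\lambda)$ for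 which there are $B_e\in K$ $(e\in P_\theta(\delta))$ such that every $a\in B$ with $a\cap\theta\ne\emptyset$ lies in $B_e$ for some $e\in P_\theta(\delta)$ with $e\in P_{|a\cap\theta|}(a\cap\delta)$. The ideal $K$ is $[\delta]^{<\theta}$-normal if $K=\nabla^{[\delta]^{<\theta}}K$. If there is a $[\delta]^{<\theta}$-normal ideal on $P_\kappa(\lambda)$, put $NS^{[\delta]^{<\theta}}_{\kappa,\lambda}=\nabla^{[\delta]^{<\bar\theta\cdot 3}}I_{\kappa,\lambda}$, and put $NS^{\delta}_{\kappa,\lambda}=NS^{[\delta]^{<2}}_{\kappa,\lambda}$. Let $\rho^{+\beta}$ denote the $\beta$-th cardinal successor of $\rho$. For a cardinal $\rho\ge\kappa$ and an ordinal $1\le\beta<\kappa$, let $A^{\rho,\beta}_{\kappa,\lambda}$ be the set of all $a\in P_\kappa(\lambda)$ such that $\alpha+1\in a$ for every $\alpha\in a\cap(\rho^{+\beta}\setminus\rho)$ and $\rho^{+\gamma}\in a$ for every $\gamma<\beta$. (1) Let $J$ be an ideal on $P_\kappa(\lambda)$ and let $\delta=\rho^{+\beta}$, where $\rho\ge\kappa$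 is a cardinal and $\beta$ is an ordinal with $1\le\beta<\bar\theta$. Then $J$ is $[\delta]^{<\theta}$-normal if and only if $J$ is $[\delta]^{<|\beta|^+}$-normal, $J$ is $[\rho]^{<\theta}$-normal, and $$\{a\in A^{\rho,\beta}_{\kappa,\lambda}:\operatorname{cf}(\textstyle\bigcup(a\cap\rho^{+(\alpha+1)}))\ge\bigcup(a\cap\bar\theta)\text{ for every }\alpha<\beta\}\in J^*.$$ Assume moreover, for (2) and (3), that there exists a $[\delta]^{<\theta}$-normal ideal on $P_\kappa(\lambda)$. (2) If $|\delta|=\kappa^{+n}$ with $n<\omega$, and $C$ is the set of all $a\in P_\kappa(\lambda)$ such that $\operatorname{cf}(\bigcup(a\cap\kappa^{+m}))\ge\bigcup(a\cap\bar\theta)$ for every $m\le n$, then $C\in(NS^\delta_{\kappa,\lambda})^+$ and $NS^{[\delta]^{<\theta}}_{\kappa,\lambda}=NS^\delta_{\kappa,\lambda}|C$. (3) If $|\delta|=\kappa^{+\beta}$ with $\omega\le\beta<\theta$, and $C$ is the set of all $a\in P_\kappa(\lambda)$ such that $\operatorname{cf}(\bigcup(a\cap\kappa))\ge\bigcup(a\cap\bar\theta)$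 and $\operatorname{cf}(\bigcup(a\cap\kappa^{+(\alpha+1)}))\ge\bigcup(a\cap\bar\theta)$ for every $\alpha<\beta$, then $C\in(NS^{[\delta]^{<|\beta|^+}}_{\kappa,\lambda})^+$ and $NS^{[\delta]^{<\theta}}_{\kappa,\lambda}=NS^{[\delta]^{<|\beta|^+}}_{\kappa,\lambda}|C$. -/

import Mathlib

universe u

noncomputable section

namespace PkLambda

open Cardinal Set

/-- `P_τ(A) = {a ⊆ A : |a| < τ}` for a set `A` of ordinals. Sets of ordinals of universe `u` have
their cardinality one universe higher. -/
def smallSubsets (τ : Cardinal.{u + 1}) (A : Set Ordinal.{u}) : Set (Set Ordinal.{u}) :=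
  {a | a ⊆ A ∧ #a < τ}

/-- `P_κ(λ)`; a cardinal is identified with the set of ordinals below its initial ordinal. -/
def Pkl (κ lam : Cardinal.{u}) : Set (Set Ordinal.{u}) :=
  smallSubsets (Cardinal.lift.{u + 1} κ) (Iio lam.ord)

/-- `P_θ(δ)` for an ordinal `δ`. -/
def Ptd (θ : Cardinal.{u}) (δ : Ordinal.{u}) : Set (Set Ordinal.{u}) :=
  smallSubsets (Cardinal.lift.{u + 1} θ) (Iio δ)

/-- `I_{κ,λ}`: the sets `B ⊆ P_κ(λ)` disjoint from `{b ∈ P_κ(λ) : a ⊆ b}` for some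
`a ∈ P_κ(λ)`. -/
def Ikl (κ lam : Cardinal.{u}) : Set (Set (Set Ordinal.{u})) :=
  {B | B ⊆ Pkl κ lam ∧ ∃ a ∈ Pkl κ lam, B ∩ {b | b ∈ Pkl κ lam ∧ a ⊆ b} = ∅}

/-- `K` is an ideal on `P_κ(λ)`. -/
structure IsIdealOn (κ lam : Cardinal.{u}) (K : Set (Set (Set Ordinal.{u}))) : Prop where
  subset_Pkl : ∀ B ∈ K, B ⊆ Pkl κ lam
  mem_of_subset : ∀ B ∈ K, ∀ B' ⊆ B, B' ∈ K
  sUnion_mem : ∀ Y ⊆ K, Y.Nonempty → #Y < Cardinal.lift.{u + 1} κ.ord.cof → ⋃₀ Y ∈ K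
  Ikl_subset : Ikl κ lam ⊆ K
  Pkl_notMem : Pkl κ lam ∉ K

/-- `K⁺`: the subsets of `P_κ(λ)` that are not in `K`. -/
def positive (κ lam : Cardinal.{u}) (K : Set (Set (Set Ordinal.{u}))) :
    Set (Set (Set Ordinal.{u})) :=
  {B | B ⊆ Pkl κ lam ∧ B ∉ K}

/-- `K*`: the subsets of `P_κ(λ)` whose complement is in `K`. -/
def dual (κ lam : Cardinal.{u}) (K : Set (Set (Set Ordinal.{u}))) :
    Set (Set (Set Ordinal.{u})) :=
  {B | B ⊆ Pkl κ lam ∧ Pkl κ lam \ B ∈ K}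

/-- The restriction `K|A`. -/
def restrict (κ lam : Cardinal.{u}) (K : Set (Set (Set Ordinal.{u}))) (A : Set (Set Ordinal.{u})) :
    Set (Set (Set Ordinal.{u})) :=
  {B | B ⊆ Pkl κ lam ∧ B ∩ A ∈ K}

/-- The diagonal union `∇_{e ∈ P_θ(δ)} X_e`, the union over `e ∈ P_θ(δ)` of the sets
`X_e ∩ {a ∈ P_κ(λ) : e ∈ P_{|a ∩ θ|}(a ∩ δ)}`. -/
def diagUnion (κ lam θ : Cardinal.{u}) (δ : Ordinal.{u})
    (X : Set Ordinal.{u} → Set (Set Ordinal.{u})) : Set (Set Ordinal.{u}) :=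
  ⋃ e ∈ Ptd θ δ, X e ∩
    {a | a ∈ Pkl κ lam ∧
      e ∈ smallSubsets #(a ∩ Iio θ.ord : Set Ordinal.{u}) (a ∩ Iio δ)}

/-- `∇^{[δ]^{<θ}} K`. Only the values `X e` with `e ∈ P_θ(δ)` matter. -/
def nabla (κ lam θ : Cardinal.{u}) (δ : Ordinal.{u}) (K : Set (Set (Set Ordinal.{u}))) :
    Set (Set (Set Ordinal.{u})) :=
  {B | ∃ X : Set Ordinal.{u} → Set (Set Ordinal.{u}), (∀ e ∈ Ptd θ δ, X e ∈ K) ∧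
    B ⊆ {a | a ∈ Pkl κ lam ∧ a ∩ Iio θ.ord = ∅} ∪ diagUnion κ lam θ δ X}

/-- `K` is `[δ]^{<θ}`-normal. -/
def IsNormal (κ lam θ : Cardinal.{u}) (δ : Ordinal.{u}) (K : Set (Set (Set Ordinal.{u}))) : Prop :=
  K = nabla κ lam θ δ K

open Classical in
/-- `θ̄`: it is `ν` if `θ = κ = ν⁺`, and `θ` otherwise. -/
def thetaBar (κ θ : Cardinal.{u}) : Cardinal.{u} :=
  if h : θ = κ ∧ ∃ ν : Cardinal.{u}, κ = Order.succ ν then h.2.choose else θ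

/-- `NS_{κ,λ}^{[δ]^{<θ}}`, the least `[δ]^{<θ}`-normal ideal on `P_κ(λ)` (if there is such an
ideal), defined as `∇^{[δ]^{<θ̄·3}} I_{κ,λ}`. -/
def NS (κ lam θ : Cardinal.{u}) (δ : Ordinal.{u}) : Set (Set (Set Ordinal.{u})) :=
  nabla κ lam (thetaBar κ θ * 3) δ (Ikl κ lam)

/-- `ρ^{+β}`, the `β`-th cardinal successor of `ρ`. -/
def plus (ρ : Cardinal.{u}) (β : Ordinal.{u}) : Cardinal.{u} :=
  Ordinal.limitRecOn β ρ (fun _ c => Order.succ c) (fun β _ f => ⨆ α : Iio β, f α.1 α.2)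

/-- `∪(a ∩ η)`: the union of a set of ordinals is its supremum (`0` for the empty set). -/
def cup (a : Set Ordinal.{u}) (η : Ordinal.{u}) : Ordinal.{u} :=
  sSup (a ∩ Iio η)

/-- `A_{κ,λ}^{ρ,β}`. -/
def Aset (κ lam ρ : Cardinal.{u}) (β : Ordinal.{u}) : Set (Set Ordinal.{u}) :=
  {a | a ∈ Pkl κ lam ∧
    (∀ α ∈ a ∩ (Iio (plus ρ β).ord \ Iio ρ.ord), α + 1 ∈ a) ∧
    (∀ γ < β, (plus ρ γ).ord ∈ a)}

/-- `cf(∪(a ∩ η)) ≥ ∪(a ∩ θ̄)`. -/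
def CofGe (κ θ : Cardinal.{u}) (a : Set Ordinal.{u}) (η : Ordinal.{u}) : Prop :=
  cup a (thetaBar κ θ).ord ≤ (cup a η).cof.ord

end PkLambda

end

noncomputable section

namespace PkLambda

open Cardinal Set Filter

variable {κ lam θ t : Cardinal.{u}} {δ : Ordinal.{u}} {J : Set (Set (Set Ordinal.{u}))}
  {F : Filter (Set Ordinal.{u})}

/-! ### Small sets of ordinals -/

/-! Ideals are replaced by their dual filters, so that `[δ]^{<θ}`-normality becomes closure under
intersections diagonal over those `e ⊆ a ∩ δ` with `|e| < |a ∩ θ|` (`DiagClosed`). In this form `θ`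
may be exchanged with `θ̄`, and, when `κ` is uncountable, with `max ℵ₀ θ̄`.

Normality forces the cofinality conditions: if `a ∩ η` had a cofinal subset `e` with fewer than `|a
∩ θ̄|` elements, diagonal closure would put `sup e + 1` into `a`
(`DiagClosed.eventually_cup_le_cof`).

Conversely, the cofinality conditions bound every small `e ⊆ a ∩ ρ^{+(α+1)}` by some `ξ ∈ a`. A
fixed enumeration of `ξ` in type `|ξ|` then pulls `e` down to `ρ^{+α}`. Descending to `ρ` uses at
most `|β|` bounds, or finitely many if `β` is finite (`exists_descent`). Thus `e` is coded by a
small subset of `ρ^{+β}`, handled by `[δ]^{<|β|^+}`-normality, and a small subset of `ρ`, handled by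
`[ρ]^{<θ}`-normality (`DiagClosed.plus_of_cof`). This is (1).

For (2) and (3), `NS` is the least normal ideal as soon as a normal ideal exists. The set `C` lies
in its dual, which gives one inclusion. For the other, minimality reduces the claim to normality of
the restriction to `C`. Descent with `ρ = κ` reduces this to closure at `κ`, which follows from the
cofinality condition at `κ` and from `|P_θ̄(ξ)| < κ` for `ξ < κ` (`DiagClosed.of_cof_of_mk_Ptd_lt`);
`DiagClosed.of_card` passes from `|δ|` to `δ`. -/

theorem mk_Iio_ord (c : Cardinal.{u}) : #(Iio c.ord) = Cardinal.lift.{u + 1} c := by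
  rw [mk_Iio_ordinal, card_ord]

theorem mk_inter_Iio_ord_le (a : Set Ordinal.{u}) (c : Cardinal.{u}) :
    #(a ∩ Iio c.ord : Set Ordinal.{u}) ≤ Cardinal.lift.{u + 1} c :=
  (mk_le_mk_of_subset inter_subset_right).trans (mk_Iio_ord c).le

theorem le_mk_inter_Iio_ord {a : Set Ordinal.{u}} {c d : Cardinal.{u}} (h : Iio c.ord ⊆ a)
    (hcd : c ≤ d) : Cardinal.lift.{u + 1} c ≤ #(a ∩ Iio d.ord : Set Ordinal.{u}) := by
  rw [← mk_Iio_ord]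
  exact mk_le_mk_of_subset (subset_inter h (Iio_subset_Iio (ord_le_ord.2 hcd)))

theorem Iio_subset_mem_Pkl {o : Ordinal.{u}} (h : o.card < κ) (hlam : κ ≤ lam) :
    Iio o ∈ Pkl κ lam := by
  refine ⟨Iio_subset_Iio ?_, ?_⟩
  · exact (lt_ord.2 (h.trans_le hlam)).le
  · rw [mk_Iio_ordinal]; exact lift_lt.2 h

theorem singleton_mem_Pkl (hκ : κ.IsRegular) {x : Ordinal.{u}} (hx : x < lam.ord) :
    {x} ∈ Pkl κ lam := by
  refine ⟨by simpa using hx, ?_⟩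
  rw [mk_singleton]
  simpa using hκ.nat_lt 1

theorem empty_mem_Pkl (hκ : κ.IsRegular) : ∅ ∈ Pkl κ lam :=
  ⟨empty_subset _, by simpa using hκ.pos⟩

theorem biUnion_mem_Pkl (hκ : κ.IsRegular) {ι : Type (u + 1)} {S : Set ι}
    (hS : #S < Cardinal.lift.{u + 1} κ) {f : ι → Set Ordinal.{u}}
    (hf : ∀ i ∈ S, f i ∈ Pkl κ lam) : ⋃ i ∈ S, f i ∈ Pkl κ lam := by
  refine ⟨iUnion₂_subset fun i hi => (hf i hi).1, ?_⟩
  exact (card_biUnion_lt_iff_forall_of_isRegular hκ.lift hS).2 fun i hi => (hf i hi).2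

theorem union_mem_Pkl (hκ : κ.IsRegular) {a b : Set Ordinal.{u}} (ha : a ∈ Pkl κ lam)
    (hb : b ∈ Pkl κ lam) : a ∪ b ∈ Pkl κ lam :=
  ⟨union_subset ha.1 hb.1, (mk_union_le a b).trans_lt
    (add_lt_of_lt hκ.lift.aleph0_le ha.2 hb.2)⟩

theorem mk_lt_of_finite (hκ : κ.IsRegular) {ι : Type (u + 1)} {S : Set ι} (hS : S.Finite) :
    #S < Cardinal.lift.{u + 1} κ :=
  (lt_aleph0_iff_set_finite.2 hS).trans_le hκ.lift.aleph0_le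

theorem Ptd_of_subset {a e : Set Ordinal.{u}} (he : e ⊆ a ∩ Iio δ)
    (hc : #e < #(a ∩ Iio t.ord : Set Ordinal.{u})) : e ∈ Ptd t δ :=
  ⟨he.trans inter_subset_right, hc.trans_le (mk_inter_Iio_ord_le a t)⟩

theorem Ptd_mono {t' : Cardinal.{u}} {δ' : Ordinal.{u}} (ht : t' ≤ t) (hδ : δ' ≤ δ) :
    Ptd t' δ' ⊆ Ptd t δ :=
  fun _ he => ⟨he.1.trans (Iio_subset_Iio hδ), he.2.trans_le (lift_le.2 ht)⟩

/-! ### Fine, `κ`-complete filters on `P_κ(λ)` -/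

/-- A proper, fine, `κ`-complete filter concentrating on `P_κ(λ)`. -/
structure IsFineFilter (κ lam : Cardinal.{u}) (F : Filter (Set Ordinal.{u})) : Prop where
  neBot : F.NeBot
  complete : CardinalInterFilter F (Cardinal.lift.{u + 1} κ)
  mem_Pkl : ∀ᶠ a in F, a ∈ Pkl κ lam
  fine : ∀ x < lam.ord, ∀ᶠ a in F, x ∈ a

theorem IsFineFilter.eventually_ball (hF : IsFineFilter κ lam F) {ι : Type (u + 1)} {S : Set ι}
    (hS : #S < Cardinal.lift.{u + 1} κ) {p : Set Ordinal.{u} → ι → Prop}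
    (h : ∀ i ∈ S, ∀ᶠ a in F, p a i) : ∀ᶠ a in F, ∀ i ∈ S, p a i :=
  have := hF.complete
  (eventually_cardinal_ball hS (p := fun a i _ => p a i)).2 h

theorem IsFineFilter.eventually_subset (hF : IsFineFilter κ lam F) {s : Set Ordinal.{u}}
    (hs : s ∈ Pkl κ lam) : ∀ᶠ a in F, s ⊆ a :=
  hF.eventually_ball hs.2 fun x hx => hF.fine x (hs.1 hx)

theorem IsFineFilter.eventually_Iio_subset (hF : IsFineFilter κ lam F) (hlam : κ ≤ lam)
    {o : Ordinal.{u}} (h : o.card < κ) : ∀ᶠ a in F, Iio o ⊆ a :=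
  hF.eventually_subset (Iio_subset_mem_Pkl h hlam)

/-- The filter dual to an ideal on `P_κ(λ)`. -/
def IsIdealOn.ae (hκ : κ.IsRegular) (hJ : IsIdealOn κ lam J) : Filter (Set Ordinal.{u}) where
  sets := {S | Pkl κ lam \ S ∈ J}
  univ_sets := by
    have : (∅ : Set (Set Ordinal.{u})) ∈ J :=
      hJ.Ikl_subset ⟨empty_subset _, ∅, empty_mem_Pkl hκ, by simp⟩
    simpa using this
  sets_of_superset := fun {S T} hS hST => hJ.mem_of_subset _ hS _ (sdiff_subset_sdiff_right hST)
  inter_sets := fun {S T} hS hT => by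
    have := hJ.sUnion_mem {Pkl κ lam \ S, Pkl κ lam \ T} (by
      rintro _ (rfl | rfl) <;> assumption) ⟨_, mem_insert _ _⟩ (by
        rw [hκ.cof_ord]
        exact mk_lt_of_finite hκ (toFinite _))
    rwa [sUnion_pair, ← sdiff_inter] at this

theorem IsIdealOn.eventually_ae (hκ : κ.IsRegular) (hJ : IsIdealOn κ lam J)
    {p : Set Ordinal.{u} → Prop} :
    (∀ᶠ a in hJ.ae hκ, p a) ↔ {a | a ∈ Pkl κ lam ∧ ¬ p a} ∈ J := by
  rw [Filter.Eventually, ← Filter.mem_sets]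
  exact Iff.rfl

theorem IsIdealOn.isFineFilter_ae (hκ : κ.IsRegular) (hJ : IsIdealOn κ lam J) :
    IsFineFilter κ lam (hJ.ae hκ) where
  neBot := by
    refine ⟨fun h => hJ.Pkl_notMem ?_⟩
    have h0 : Pkl κ lam \ ∅ ∈ J := empty_mem_iff_bot.2 h
    rwa [sdiff_empty] at h0
  complete := by
    refine ⟨fun S hS h => ?_⟩
    rcases S.eq_empty_or_nonempty with rfl | hne
    · simp
    have := hJ.sUnion_mem ((fun T => Pkl κ lam \ T) '' S) (by
      rintro _ ⟨T, hT, rfl⟩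
      exact h T hT) (hne.image _) (by
        rw [hκ.cof_ord]
        exact mk_image_le.trans_lt hS)
    change Pkl κ lam \ ⋂₀ S ∈ J
    convert this using 1
    ext a
    simp
  mem_Pkl := by
    rw [hJ.eventually_ae hκ]
    refine hJ.Ikl_subset ⟨fun a ha => ha.1, ∅, empty_mem_Pkl hκ, ?_⟩
    ext a; simp
  fine := fun x hx => by
    rw [hJ.eventually_ae hκ]
    refine hJ.Ikl_subset ⟨fun a ha => ha.1, {x}, singleton_mem_Pkl hκ hx, ?_⟩
    ext a; simp; tauto

/-! ### Closure under diagonal intersections -/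

/-- The filter-theoretic form of `[δ]^{<t}`-normality. -/
def DiagClosed (F : Filter (Set Ordinal.{u})) (t : Cardinal.{u}) (δ : Ordinal.{u}) : Prop :=
  ∀ P : Set Ordinal.{u} → Set Ordinal.{u} → Prop, (∀ e ∈ Ptd t δ, ∀ᶠ a in F, P e a) →
    ∀ᶠ a in F, ∀ e ⊆ a ∩ Iio δ, #e < #(a ∩ Iio t.ord : Set Ordinal.{u}) → P e a

theorem subset_nabla (hθ : θ ≠ 0) (hJ : ∀ B ∈ J, B ⊆ Pkl κ lam) : J ⊆ nabla κ lam θ δ J := by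
  intro B hB
  refine ⟨fun _ => B, fun _ _ => hB, fun a ha => ?_⟩
  by_cases h : a ∩ Iio θ.ord = ∅
  · exact Or.inl ⟨hJ B hB ha, h⟩
  · refine Or.inr (mem_iUnion₂.2 ⟨∅, ⟨empty_subset _, ?_⟩, ha, hJ B hB ha, empty_subset _, ?_⟩)
    · simpa [pos_iff_ne_zero] using hθ
    · rw [mk_eq_zero, pos_iff_ne_zero, mk_ne_zero_iff]
      exact (nonempty_iff_ne_empty.2 h).to_subtype

theorem nabla_mono {K : Set (Set (Set Ordinal.{u}))} (h : J ⊆ K) :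
    nabla κ lam θ δ J ⊆ nabla κ lam θ δ K :=
  fun _ ⟨X, hX, hB⟩ => ⟨X, fun e he => h (hX e he), hB⟩

theorem IsIdealOn.isNormal_iff_nabla_subset (hJ : IsIdealOn κ lam J) (hθ : θ ≠ 0) :
    IsNormal κ lam θ δ J ↔ nabla κ lam θ δ J ⊆ J :=
  ⟨fun h => h.symm.subset, fun h => (subset_nabla hθ hJ.subset_Pkl).antisymm h⟩

theorem zero_lt_ord (hκ : κ.IsRegular) (hlam : κ ≤ lam) : (0 : Ordinal.{u}) < lam.ord :=
  hκ.ord_pos.trans_le (ord_le_ord.2 hlam)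

theorem IsIdealOn.isNormal_iff (hκ : κ.IsRegular) (hlam : κ ≤ lam) (hJ : IsIdealOn κ lam J)
    (hθ : θ ≠ 0) : IsNormal κ lam θ δ J ↔ DiagClosed (hJ.ae hκ) θ δ := by
  rw [hJ.isNormal_iff_nabla_subset hθ]
  constructor
  · intro h P hP
    rw [hJ.eventually_ae hκ]
    refine h ⟨fun e => {a | a ∈ Pkl κ lam ∧ ¬ P e a},
      fun e he => (hJ.eventually_ae hκ).1 (hP e he), ?_⟩
    rintro a ⟨ha, hn⟩
    push Not at hn
    obtain ⟨e, he, hc, hn⟩ := hn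
    exact Or.inr (mem_iUnion₂.2 ⟨e, Ptd_of_subset he hc, ⟨ha, hn⟩, ha, he, hc⟩)
  · rintro h B ⟨X, hX, hB⟩
    have h1 := h (fun e a => a ∉ X e) (fun e he => by
      rw [hJ.eventually_ae hκ]
      exact hJ.mem_of_subset _ (hX e he) _ fun a ha => by simpa using ha.2)
    -- Almost every `a` contains `0`, so the clause `a ∩ θ = ∅` of the diagonal union is negligible.
    have h2 := (h1.and ((hJ.isFineFilter_ae hκ).fine 0 (zero_lt_ord hκ hlam)))
    refine hJ.mem_of_subset _ ((hJ.eventually_ae hκ).1 h2) _ fun a ha => ?_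
    rcases hB ha with ⟨haP, h0⟩ | hd
    · refine ⟨haP, fun hh => ?_⟩
      have : (0 : Ordinal.{u}) ∈ a ∩ Iio θ.ord := ⟨hh.2, by
        rw [mem_Iio, lt_ord]; simpa [pos_iff_ne_zero] using hθ⟩
      simp [h0] at this
    · obtain ⟨e, he, hXe, haP, hea, hc⟩ := mem_iUnion₂.1 hd
      exact ⟨haP, fun hh => hh.1 e hea hc hXe⟩

theorem DiagClosed.mono (h : DiagClosed F t δ) {t' : Cardinal.{u}} {δ' : Ordinal.{u}}
    (ht : t' ≤ t) (hδ : δ' ≤ δ) : DiagClosed F t' δ' := by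
  intro P hP
  filter_upwards [h (fun e a => e ∈ Ptd t' δ' → P e a) fun e _ => by
    by_cases he : e ∈ Ptd t' δ'
    · filter_upwards [hP e he] with a ha _ using ha
    · exact Eventually.of_forall fun a h => absurd h he] with a ha e he hc
  exact ha e (he.trans (inter_subset_inter_right _ (Iio_subset_Iio hδ)))
    (hc.trans_le (mk_le_mk_of_subset (inter_subset_inter_right _
      (Iio_subset_Iio (ord_le_ord.2 ht))))) (Ptd_of_subset he hc)

/-! ### The cardinal `θ̄` -/

theorem thetaBar_cases (κ θ : Cardinal.{u}) :
    (thetaBar κ θ = θ ∧ (θ = κ → ∀ ν, κ ≠ Order.succ ν)) ∨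
      (θ = κ ∧ κ = Order.succ (thetaBar κ θ)) := by
  unfold thetaBar
  split_ifs with h
  · exact Or.inr ⟨h.1, h.2.choose_spec⟩
  · refine Or.inl ⟨rfl, fun h1 ν h2 => h ⟨h1, ν, h2⟩⟩

theorem thetaBar_le (κ θ : Cardinal.{u}) : thetaBar κ θ ≤ θ := by
  rcases thetaBar_cases κ θ with h | h
  · exact h.1.le
  · exact (Order.le_succ _).trans_eq (h.2.symm.trans h.1.symm)

theorem two_le_thetaBar (hκ : κ.IsRegular) (hθ : 2 ≤ θ) : 2 ≤ thetaBar κ θ := by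
  rcases thetaBar_cases κ θ with h | h
  · rwa [h.1]
  · have h2 : (2 : Cardinal.{u}) < κ := hκ.nat_lt 2
    exact Order.lt_succ_iff.1 (h2.trans_eq h.2)

theorem succ_lt_of_thetaBar_eq (h : thetaBar κ θ = κ) {μ : Cardinal.{u}}
    (hμ : μ < κ) : Order.succ μ < κ := by
  rcases thetaBar_cases κ θ with h' | h'
  · exact lt_of_le_of_ne (Order.succ_le_of_lt hμ)
      (h'.2 (h'.1.symm.trans h) μ).symm
  · have := h'.2
    rw [h] at this
    exact absurd this (Order.lt_succ κ).ne

theorem thetaBar_eq_self (h : θ ≠ κ) : thetaBar κ θ = θ := by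
  rcases thetaBar_cases κ θ with h' | h'
  · exact h'.1
  · exact absurd h'.1 h

/-- Only `θ = κ = ν⁺` needs an argument: almost every `a` includes `ν`, while `|a ∩ κ| < ν⁺`, so the
size bounds `|a ∩ θ|` and `|a ∩ ν|` agree. -/
theorem diagClosed_thetaBar_iff (hlam : κ ≤ lam) (hF : IsFineFilter κ lam F) :
    DiagClosed F (thetaBar κ θ) δ ↔ DiagClosed F θ δ := by
  refine ⟨fun h => ?_, fun h => h.mono (thetaBar_le κ θ) le_rfl⟩
  rcases thetaBar_cases κ θ with h' | h'
  · rwa [h'.1] at h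
  · have hlt : thetaBar κ θ < κ := by
      conv_rhs => rw [h'.2]
      exact Order.lt_succ _
    intro P hP
    filter_upwards [h P fun e he => hP e (Ptd_mono (thetaBar_le κ θ) le_rfl he), hF.mem_Pkl,
      hF.eventually_Iio_subset hlam (o := (thetaBar κ θ).ord) (by rwa [card_ord])]
      with a ha haP hsub e he hc
    refine ha e he (hc.trans_le ?_)
    refine le_trans ?_ (le_mk_inter_Iio_ord hsub le_rfl)
    have h1 : #(a ∩ Iio θ.ord : Set Ordinal.{u}) < Cardinal.lift.{u + 1} κ :=
      (mk_le_mk_of_subset inter_subset_left).trans_lt haP.2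
    have h2 : Cardinal.lift.{u + 1} κ = Order.succ (Cardinal.lift.{u + 1} (thetaBar κ θ)) := by
      rw [← lift_succ, ← h'.2]
    exact Order.lt_succ_iff.1 (h1.trans_eq h2)

/-! ### Consequences of closure under diagonal intersections -/

theorem DiagClosed.eventually_forall_mem (hκ : κ.IsRegular) (hlam : κ ≤ lam)
    (hF : IsFineFilter κ lam F) (h : DiagClosed F t δ) (ht : 2 ≤ t)
    {Q : Ordinal.{u} → Set Ordinal.{u} → Prop} (hQ : ∀ x < δ, ∀ᶠ a in F, Q x a) :
    ∀ᶠ a in F, ∀ x ∈ a, x < δ → Q x a := by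
  have h2 : (2 : Cardinal.{u}).ord.card < κ := by rw [card_ord]; exact hκ.nat_lt 2
  filter_upwards [h (fun e a => ∀ x, e = {x} → Q x a) fun e he => by
    by_cases hx : ∃ x, e = {x}
    · obtain ⟨x, rfl⟩ := hx
      filter_upwards [hQ x (by simpa using he.1)] with a ha y hy
      rwa [← singleton_injective hy]
    · exact Eventually.of_forall fun a x hx' => absurd ⟨x, hx'⟩ hx,
    hF.eventually_Iio_subset hlam h2] with a ha hsub x hx hxδ
  refine ha {x} (by simp [hx, hxδ]) ?_ x rfl
  refine lt_of_lt_of_le ?_ (le_mk_inter_Iio_ord hsub ht)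
  rw [mk_singleton]
  simp

theorem DiagClosed.eventually_closed (hκ : κ.IsRegular) (hlam : κ ≤ lam)
    (hF : IsFineFilter κ lam F) (h : DiagClosed F t δ) (ht : 2 ≤ t)
    {f : Ordinal.{u} → Set Ordinal.{u}} (hf : ∀ x < δ, f x ∈ Pkl κ lam) :
    ∀ᶠ a in F, ∀ x ∈ a, x < δ → f x ⊆ a :=
  h.eventually_forall_mem hκ hlam hF ht fun x hx => hF.eventually_subset (hf x hx)

theorem DiagClosed.eventually_add_one_mem (hκ : κ.IsRegular) (hlam : κ ≤ lam)
    (hF : IsFineFilter κ lam F) (h : DiagClosed F t δ) (ht : 2 ≤ t) (hδ : δ ≤ lam.ord) :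
    ∀ᶠ a in F, ∀ x ∈ a, x < δ → x + 1 ∈ a := by
  refine h.eventually_forall_mem hκ hlam hF ht fun x hx => hF.fine _ ?_
  exact (isSuccLimit_ord (hκ.aleph0_le.trans hlam)).succ_lt (hx.trans_le hδ)

/-- If `κ = ω`, almost every `a` would be finite, nonempty below `κ` and closed under successor
there, hence without a maximum. -/
theorem DiagClosed.aleph0_lt (hκ : κ.IsRegular) (hlam : κ ≤ lam) (hF : IsFineFilter κ lam F)
    (h : DiagClosed F t δ) (ht : 2 ≤ t) (hδ : δ ≤ lam.ord) (hκδ : κ.ord ≤ δ) : ℵ₀ < κ := by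
  refine lt_of_le_of_ne hκ.aleph0_le fun hω => ?_
  have := hF.neBot
  obtain ⟨a, haP, h0, hs⟩ := (hF.mem_Pkl.and ((hF.fine 0 (zero_lt_ord hκ hlam)).and
    (h.eventually_add_one_mem hκ hlam hF ht hδ))).exists
  have hfin : (a ∩ Iio κ.ord).Finite := by
    refine Set.Finite.subset ?_ inter_subset_left
    have : #a < Cardinal.lift.{u + 1} κ := haP.2
    rw [← hω, lift_aleph0] at this
    exact lt_aleph0_iff_set_finite.1 this
  obtain ⟨m, hm⟩ := hfin.exists_maximal ⟨0, h0, hκ.ord_pos⟩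
  have h1 : m + 1 ∈ a ∩ Iio κ.ord :=
    ⟨hs m hm.1.1 (lt_of_lt_of_le hm.1.2 hκδ), (isSuccLimit_ord hκ.aleph0_le).succ_lt hm.1.2⟩
  exact absurd (hm.2 h1 (Order.le_succ m)) (not_le.2 (Order.lt_succ m))

/-- Finite sets are reached by iterating the diagonal intersection over single ordinals, one element
at a time. Uncountability of `κ` allows all sizes `n` to be intersected at once. -/
theorem DiagClosed.eventually_forall_finite (hκ : κ.IsRegular) (hlam : κ ≤ lam)
    (hF : IsFineFilter κ lam F) (h : DiagClosed F t δ) (ht : 2 ≤ t) (hω : ℵ₀ < κ)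
    {P : Set Ordinal.{u} → Set Ordinal.{u} → Prop}
    (hP : ∀ e ⊆ Iio δ, e.Finite → ∀ᶠ a in F, P e a) :
    ∀ᶠ a in F, ∀ e ⊆ a ∩ Iio δ, e.Finite → P e a := by
  have key : ∀ (n : ℕ) (P : Set Ordinal.{u} → Set Ordinal.{u} → Prop),
      (∀ e ⊆ Iio δ, e.Finite → ∀ᶠ a in F, P e a) →
      ∀ᶠ a in F, ∀ e : Finset Ordinal.{u}, (e : Set Ordinal.{u}) ⊆ a ∩ Iio δ → e.card = n →
        P e a := by
    intro n
    induction n with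
    | zero =>
      intro P hP
      filter_upwards [hP ∅ (empty_subset _) finite_empty] with a ha e _ hc
      rw [Finset.card_eq_zero.1 hc]
      simpa using ha
    | succ n ih =>
      intro P hP
      filter_upwards [h.eventually_forall_mem hκ hlam hF ht fun x hx =>
        ih (fun e a => P (insert x e) a) fun e he hf => hP _ (insert_subset hx he) (hf.insert x)]
        with a ha e he hc
      obtain ⟨x, e', hx, rfl, hc'⟩ := Finset.card_eq_succ.1 hc
      rw [Finset.coe_insert] at he ⊢
      have hxa := he (mem_insert _ _)
      exact ha x hxa.1 hxa.2 e' ((subset_insert _ _).trans he) hc'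
  have hall : ∀ᶠ a in F, ∀ n ∈ (univ : Set (ULift.{u + 1} ℕ)), ∀ e : Finset Ordinal.{u},
      (e : Set Ordinal.{u}) ⊆ a ∩ Iio δ → e.card = n.down → P e a := by
    refine hF.eventually_ball ?_ fun n _ => key n.down P hP
    rw [mk_univ, mk_uLift, mk_nat, lift_aleph0, ← lift_aleph0.{u + 1, u}]
    exact lift_lt.2 hω
  filter_upwards [hall] with a ha e he hf
  have := ha ⟨hf.toFinset.card⟩ trivial hf.toFinset (by simpa using he) rfl
  simpa using this

theorem diagClosed_max_aleph0_iff (hκ : κ.IsRegular) (hlam : κ ≤ lam)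
    (hF : IsFineFilter κ lam F) (ht : 2 ≤ t) (hω : ℵ₀ < κ) :
    DiagClosed F (max ℵ₀ t) δ ↔ DiagClosed F t δ := by
  refine ⟨fun h => h.mono (le_max_right _ _) le_rfl, fun h => ?_⟩
  rcases le_total ℵ₀ t with h' | h'
  · rwa [max_eq_right h']
  rw [max_eq_left h']
  intro P hP
  filter_upwards [h.eventually_forall_finite hκ hlam hF ht hω (P := P) fun e he hf =>
    hP e ⟨he, by rw [lift_aleph0]; exact lt_aleph0_iff_set_finite.2 hf⟩] with a ha e he hc
  refine ha e he (lt_aleph0_iff_set_finite.1 (hc.trans_le ?_))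
  simpa using mk_inter_Iio_ord_le a ℵ₀

theorem IsFineFilter.eventually_lt_mk (hlam : κ ≤ lam) (hF : IsFineFilter κ lam F) (ht : t ≤ κ)
    (hlim : t = κ → ∀ μ < κ, Order.succ μ < κ) {μ : Cardinal.{u}} (hμ : μ < t) :
    ∀ᶠ a in F, Cardinal.lift.{u + 1} μ < #(a ∩ Iio t.ord : Set Ordinal.{u}) := by
  have hs : Order.succ μ ≤ t ∧ Order.succ μ < κ := by
    refine ⟨Order.succ_le_of_lt hμ, ?_⟩
    rcases ht.lt_or_eq with h | h
    · exact (Order.succ_le_of_lt hμ).trans_lt h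
    · exact hlim h μ (h ▸ hμ)
  filter_upwards [hF.eventually_Iio_subset hlam (o := (Order.succ μ).ord)
    (by rw [card_ord]; exact hs.2)] with a ha
  exact (lift_lt.2 (Order.lt_succ μ)).trans_le (le_mk_inter_Iio_ord ha hs.1)

/-! ### Cofinalities -/

theorem bddAbove_inter_Iio (a : Set Ordinal.{u}) (η : Ordinal.{u}) : BddAbove (a ∩ Iio η) :=
  ⟨η, fun _ hx => (le_of_lt hx.2)⟩

section

variable {a : Set Ordinal.{u}} {η : Ordinal.{u}}

theorem lt_cup (hs : ∀ x ∈ a, x < η → ∃ y ∈ a, y < η ∧ x < y) {x : Ordinal.{u}} (hx : x ∈ a)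
    (hxη : x < η) : x < cup a η := by
  obtain ⟨y, hy, hyη, hxy⟩ := hs x hx hxη
  exact hxy.trans_le (le_csSup (bddAbove_inter_Iio a η) ⟨hy, hyη⟩)

theorem exists_lt_of_lt_cup {x : Ordinal.{u}} (hx : x < cup a η) : ∃ y ∈ a, y < η ∧ x < y := by
  by_contra! h
  exact hx.not_ge (csSup_le' fun y hy => h y hy.1 hy.2)

theorem isSuccLimit_cup (hne : ∃ x ∈ a, x < η) (hs : ∀ x ∈ a, x < η → ∃ y ∈ a, y < η ∧ x < y) :
    Order.IsSuccLimit (cup a η) := by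
  obtain ⟨x, hx, hxη⟩ := hne
  refine Ordinal.isSuccLimit_iff.2 ⟨(lt_cup hs hx hxη).ne_bot, ?_⟩
  refine Order.isSuccPrelimit_of_succ_lt fun z hz => ?_
  obtain ⟨y, hy, hyη, hzy⟩ := exists_lt_of_lt_cup hz
  exact (Order.succ_le_of_lt hzy).trans_lt (lt_cup hs hy hyη)

/-- This is how the cofinality condition is used: it makes `|e|` smaller than the cofinality of `sup
(a ∩ η)`, so `e` is bounded inside `a ∩ η`. -/
theorem exists_bound_of_mk_lt (hne : ∃ x ∈ a, x < η)
    (hs : ∀ x ∈ a, x < η → ∃ y ∈ a, y < η ∧ x < y)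
    (hcof : cup a t.ord ≤ (cup a η).cof.ord) {e : Set Ordinal.{u}} (he : e ⊆ a ∩ Iio η)
    (hc : #e < #(a ∩ Iio t.ord : Set Ordinal.{u})) : ∃ ξ ∈ a, ξ < η ∧ ∀ x ∈ e, x < ξ := by
  have hlim := isSuccLimit_cup hne hs
  have hlt : #e < Cardinal.lift.{u + 1} (cup a η).cof := by
    rcases lt_or_ge #e ℵ₀ with h | h
    · refine h.trans_le ?_
      rw [aleph0_le_lift]
      exact Ordinal.aleph0_le_cof_iff.2 (Ordinal.one_lt_cof_iff.2 hlim)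
    -- The supremum of `a ∩ t` may belong to it, hence the `+ 1`. It is absorbed because the
    -- cardinal is infinite; finite `e` were treated separately for this reason.
    · have h1 : #(a ∩ Iio t.ord : Set Ordinal.{u}) ≤
          Cardinal.lift.{u + 1} (cup a t.ord).card + 1 := by
        have : a ∩ Iio t.ord ⊆ Iio (cup a t.ord + 1) := fun x hx =>
          Order.lt_succ_iff.2 (le_csSup (bddAbove_inter_Iio a _) hx)
        refine (mk_le_mk_of_subset this).trans ?_
        rw [mk_Iio_ordinal, Ordinal.card_add_one, lift_add, lift_one]
      have h2 : ℵ₀ ≤ Cardinal.lift.{u + 1} (cup a t.ord).card := by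
        by_contra! h3
        exact ((h.trans_lt (hc.trans_le h1)).trans (add_lt_aleph0 h3 one_lt_aleph0)).false
      rw [add_one_eq h2] at h1
      refine (hc.trans_le h1).trans_le (lift_le.2 ?_)
      simpa using Ordinal.card_le_card hcof
  have hsup : sSup e < cup a η := by
    refine Ordinal.sSup_lt_of_lt_cof (by rwa [← Ordinal.lift_cof]) fun x hx => ?_
    exact lt_cup hs (he hx).1 (he hx).2
  obtain ⟨y, hy, hyη, hlt⟩ := exists_lt_of_lt_cup hsup
  exact ⟨y, hy, hyη, fun x hx =>
    (le_csSup ((bddAbove_inter_Iio a η).mono he) hx).trans_lt hlt⟩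

theorem exists_cofinal_subset :
    ∃ e ⊆ a ∩ Iio η, #e ≤ Cardinal.lift.{u + 1} (cup a η).cof ∧
      ∀ x < cup a η, ∃ y ∈ e, x < y := by
  obtain ⟨S, hS, hcard⟩ := Order.exists_cof_eq (α := Iio (cup a η))
  choose f hf using fun s : Iio (cup a η) => exists_lt_of_lt_cup s.2
  refine ⟨f '' S, ?_, ?_, ?_⟩
  · rintro _ ⟨s, -, rfl⟩
    exact ⟨(hf s).1, (hf s).2.1⟩
  · refine mk_image_le.trans ?_
    rw [hcard, Ordinal.cof_Iio, Ordinal.lift_cof]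
  · intro x hx
    obtain ⟨s, hs, hxs⟩ := hS ⟨x, hx⟩
    exact ⟨f s, mem_image_of_mem _ hs, lt_of_le_of_lt hxs (hf s).2.2⟩

end

/-- This compares the supremum of `a ∩ t` with its size. If `t < κ`, almost every `a` includes `t`.
If `t = κ`, then `κ` is a limit cardinal, and almost every `a` includes the cardinal `|ξ|⁺` for each
`ξ ∈ a ∩ κ`. -/
theorem DiagClosed.eventually_lt_mk_of_lt_cup (hκ : κ.IsRegular) (hlam : κ ≤ lam)
    (hF : IsFineFilter κ lam F) (h : DiagClosed F t δ) (ht2 : 2 ≤ t) (ht : t ≤ κ)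
    (hlim : t = κ → ∀ μ < κ, Order.succ μ < κ) (hκδ : κ.ord ≤ δ) :
    ∀ᶠ a in F, ∀ μ : Cardinal.{u}, μ.ord < cup a t.ord →
      Cardinal.lift.{u + 1} μ < #(a ∩ Iio t.ord : Set Ordinal.{u}) := by
  rcases ht.lt_or_eq with htκ | htκ
  · filter_upwards [hF.eventually_Iio_subset hlam (o := t.ord) (by rwa [card_ord])] with a ha μ hμ
    refine lt_of_lt_of_le (lift_lt.2 (ord_lt_ord.1 (hμ.trans_le ?_))) (le_mk_inter_Iio_ord ha le_rfl)
    exact csSup_le' fun x hx => le_of_lt hx.2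
  · filter_upwards [(h.mono le_rfl hκδ).eventually_closed hκ hlam hF ht2
      (f := fun ξ => Iio (Order.succ ξ.card).ord) fun ξ hξ =>
        Iio_subset_mem_Pkl (by rw [card_ord]; exact hlim htκ _ (lt_ord.1 hξ)) hlam] with a ha μ hμ
    obtain ⟨ξ, hξ, hξt, hμξ⟩ := exists_lt_of_lt_cup hμ
    have h1 := ha ξ hξ (htκ ▸ hξt)
    refine lt_of_lt_of_le (lift_lt.2 (Order.lt_succ_of_le ?_)) (le_mk_inter_Iio_ord h1 ?_)
    · simpa using Ordinal.card_le_card hμξ.le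
    · exact Order.succ_le_of_lt (lt_ord.1 hξt)

theorem DiagClosed.eventually_cup_le_cof (hκ : κ.IsRegular) (hlam : κ ≤ lam)
    (hF : IsFineFilter κ lam F) (h : DiagClosed F t δ) (ht2 : 2 ≤ t) (ht : t ≤ κ)
    (hlim : t = κ → ∀ μ < κ, Order.succ μ < κ) {η : Cardinal.{u}} (hη : η.IsRegular)
    (hκη : κ ≤ η) (hηδ : η.ord ≤ δ) (hδ : δ ≤ lam.ord) :
    ∀ᶠ a in F, cup a t.ord ≤ (cup a η.ord).cof.ord := by
  filter_upwards [h.eventually_add_one_mem hκ hlam hF ht2 hδ,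
    h.eventually_lt_mk_of_lt_cup hκ hlam hF ht2 ht hlim ((ord_le_ord.2 hκη).trans hηδ),
    -- The restriction to `e ⊆ η` matters: by regularity of `η` it keeps `sup e + 1` below `η`,
    -- hence below `λ`.
    h (fun e a => e ⊆ Iio η.ord → sSup e + 1 ∈ a) fun e he => by
      by_cases heη : e ⊆ Iio η.ord
      · filter_upwards [hF.fine (sSup e + 1) (by
          refine ((isSuccLimit_ord hη.aleph0_le).succ_lt ?_).trans_le (hηδ.trans hδ)
          refine Ordinal.sSup_lt_of_lt_cof ?_ heη
          rw [← Ordinal.lift_cof, hη.cof_ord]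
          exact he.2.trans_le (lift_le.2 (ht.trans hκη)))] with a ha _ using ha
      · exact Eventually.of_forall fun a h => absurd h heη] with a hs hlt hP
  by_contra! hcon
  obtain ⟨e, he, hcard, hcof⟩ := exists_cofinal_subset (a := a) (η := η.ord)
  have hec := hcard.trans_lt (hlt _ hcon)
  have hmem := hP e (he.trans (inter_subset_inter_right _ (Iio_subset_Iio hηδ))) hec
    (he.trans inter_subset_right)
  have hsup : sSup e < η.ord := by
    refine Ordinal.sSup_lt_of_lt_cof ?_ (he.trans inter_subset_right)
    rw [← Ordinal.lift_cof, hη.cof_ord]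
    exact (hec.trans_le (mk_inter_Iio_ord_le a t)).trans_le (lift_le.2 (ht.trans hκη))
  have hlimη := isSuccLimit_ord hη.aleph0_le
  have hlt' : sSup e + 1 < cup a η.ord := by
    refine lt_cup (fun x hx hxη => ⟨x + 1, hs x hx (hxη.trans_le hηδ), hlimη.succ_lt hxη,
      Order.lt_succ x⟩) hmem (hlimη.succ_lt hsup)
  obtain ⟨y, hy, hlty⟩ := hcof _ hlt'
  have := le_csSup ((bddAbove_inter_Iio a η.ord).mono he) hy
  exact absurd (hlty.trans_le this) (not_lt.2 (Order.le_succ (sSup e)))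

/-! ### Iterated cardinal successors -/

theorem plus_zero (ρ : Cardinal.{u}) : plus ρ 0 = ρ := by
  rw [plus, Ordinal.limitRecOn_zero]

theorem plus_add_one (ρ : Cardinal.{u}) (β : Ordinal.{u}) :
    plus ρ (β + 1) = Order.succ (plus ρ β) := by
  rw [plus, Ordinal.limitRecOn_add_one, plus]

theorem plus_of_isSuccLimit (ρ : Cardinal.{u}) {β : Ordinal.{u}} (hβ : Order.IsSuccLimit β) :
    plus ρ β = ⨆ α : Iio β, plus ρ α := by
  rw [plus, Ordinal.limitRecOn_limit _ _ _ _ hβ]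
  rfl

theorem plus_strictMono (ρ : Cardinal.{u}) : StrictMono (plus ρ) := by
  intro α β
  induction β using Ordinal.limitRecOn with
  | zero => exact fun h => absurd h not_lt_zero
  | add_one β ih =>
    intro h
    rw [plus_add_one, Order.lt_succ_iff]
    rcases (Order.lt_succ_iff.1 h).lt_or_eq with h | rfl
    · exact (ih h).le
    · exact le_rfl
  | limit β hβ ih =>
    intro h
    have h1 := hβ.succ_lt h
    rw [plus_of_isSuccLimit ρ hβ]
    refine lt_of_lt_of_le ?_ (le_ciSup bddAbove_of_small (⟨Order.succ α, h1⟩ : Iio β))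
    change _ < plus ρ (α + 1)
    rw [plus_add_one]
    exact Order.lt_succ _

theorem le_plus (ρ : Cardinal.{u}) (β : Ordinal.{u}) : ρ ≤ plus ρ β := by
  conv_lhs => rw [← plus_zero ρ]
  exact (plus_strictMono ρ).monotone zero_le

theorem exists_lt_plus_of_isSuccLimit {ρ : Cardinal.{u}} {β x : Ordinal.{u}}
    (hβ : Order.IsSuccLimit β) (hx : x < (plus ρ β).ord) : ∃ α < β, x < (plus ρ α).ord := by
  rw [lt_ord, plus_of_isSuccLimit ρ hβ] at hx
  obtain ⟨⟨α, hα⟩, h⟩ := exists_lt_of_lt_ciSup' hx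
  exact ⟨α, hα, lt_ord.2 h⟩

theorem isRegular_plus_add_one {ρ : Cardinal.{u}} (hρ : ℵ₀ ≤ ρ) (α : Ordinal.{u}) :
    (plus ρ (α + 1)).IsRegular := by
  rw [plus_add_one]
  exact isRegular_succ (hρ.trans (le_plus ρ α))

/-! ### Coding small subsets of `ρ^{+β}` by small subsets of `ρ` -/

theorem exists_surjOn_card_ord (ξ : Ordinal.{u}) :
    ∃ g : Ordinal.{u} → Ordinal.{u}, ∀ x < ξ, ∃ y < ξ.card.ord, g y = x := by
  have h : #(Iio ξ) = #(Iio ξ.card.ord) := by rw [mk_Iio_ord, mk_Iio_ordinal]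
  obtain ⟨f⟩ := Cardinal.eq.1 h
  classical
  refine ⟨fun y => if hy : y < ξ.card.ord then (f.symm ⟨y, hy⟩).1 else 0, fun x hx =>
    ⟨(f ⟨x, hx⟩).1, (f ⟨x, hx⟩).2, ?_⟩⟩
  have : (f ⟨x, hx⟩).1 < ξ.card.ord := (f ⟨x, hx⟩).2
  simp only [this, dif_pos]
  exact congrArg Subtype.val (f.symm_apply_apply ⟨x, hx⟩)

/-- A successor stage spends one bound `ξ` and replaces `e` by its preimage under the enumeration `g
ξ`. A limit stage splits `e` into its parts below the smaller cardinals and collects the bounds.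
Each element passes only finitely many successor stages, hence the finite lists; the set `d` of
bounds does not depend on the element. -/
theorem exists_descent {ρ : Cardinal.{u}} {β : Ordinal.{u}} {a : Set Ordinal.{u}}
    {c : Cardinal.{u + 1}} {g : Ordinal.{u} → Ordinal.{u} → Ordinal.{u}}
    (hg : ∀ ξ ∈ a, ξ < (plus ρ β).ord → ∀ x ∈ a, x < ξ → ∃ y ∈ a, y < ξ.card.ord ∧ g ξ y = x)
    (hb : ∀ α < β, ∀ e ⊆ a ∩ Iio (plus ρ (α + 1)).ord, #e < c →
      ∃ ξ ∈ a, ξ < (plus ρ (α + 1)).ord ∧ ∀ x ∈ e, x < ξ)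
    (α : Ordinal.{u}) (hα : α ≤ β) {e : Set Ordinal.{u}} (he : e ⊆ a ∩ Iio (plus ρ α).ord)
    (hc : #e < c) :
    ∃ d ⊆ a ∩ Iio (plus ρ α).ord, #d < Cardinal.lift.{u + 1} (max ℵ₀ (Order.succ α.card)) ∧
      ∀ x ∈ e, ∃ L : List Ordinal.{u}, (∀ ξ ∈ L, ξ ∈ d) ∧
        ∃ y ∈ a, y < ρ.ord ∧ L.foldr g y = x := by
  have hmax : ∀ c : Cardinal.{u}, ℵ₀ ≤ Cardinal.lift.{u + 1} (max ℵ₀ c) := fun c => by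
    rw [aleph0_le_lift]; exact le_max_left _ _
  induction α using Ordinal.limitRecOn generalizing e with
  | zero =>
    rw [plus_zero] at he ⊢
    refine ⟨∅, empty_subset _, ?_, fun x hx => ⟨[], by simp, x, (he hx).1, (he hx).2, rfl⟩⟩
    rw [mk_eq_zero]
    exact aleph0_pos.trans_le (hmax _)
  | add_one α ih =>
    have hαβ : α < β := (Order.lt_succ α).trans_le hα
    obtain ⟨ξ, hξ, hξα, hlt⟩ := hb α hαβ e he hc
    have hξβ : ξ < (plus ρ β).ord :=
      hξα.trans_le (ord_le_ord.2 ((plus_strictMono ρ).monotone hα))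
    choose! f hfa hfξ hgf using fun x hx => hg ξ hξ hξβ x (he hx).1 (hlt x hx)
    have hcard : ξ.card.ord ≤ (plus ρ α).ord := by
      rw [plus_add_one] at hξα
      exact ord_le_ord.2 (card_le_iff.2 hξα)
    obtain ⟨d, hd, hdc, hL⟩ := ih hαβ.le (e := f '' e) (by
      rintro _ ⟨x, hx, rfl⟩
      exact ⟨hfa x hx, (hfξ x hx).trans_le hcard⟩) (mk_image_le.trans_lt hc)
    refine ⟨insert ξ d, insert_subset ⟨hξ, hξα⟩ (hd.trans (inter_subset_inter_right _
      (Iio_subset_Iio (ord_le_ord.2 ((plus_strictMono ρ).monotone (Order.le_succ α)))))), ?_, ?_⟩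
    · refine mk_insert_le.trans_lt (add_lt_of_lt (hmax _) (hdc.trans_le (lift_le.2 ?_))
        (one_lt_aleph0.trans_le (hmax _)))
      exact max_le_max le_rfl (Order.succ_le_succ (Ordinal.card_le_card (Order.le_succ α)))
    · intro x hx
      obtain ⟨L, hLd, y, hy, hyρ, hfold⟩ := hL _ (mem_image_of_mem f hx)
      refine ⟨ξ :: L, ?_, y, hy, hyρ, ?_⟩
      · intro ζ hζ
        rcases List.mem_cons.1 hζ with rfl | h
        · exact mem_insert _ _
        · exact mem_insert_of_mem _ (hLd ζ h)
      · rw [List.foldr_cons, hfold, hgf x hx]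
  | limit α hlim ih =>
    have hω : ℵ₀ ≤ α.card := Ordinal.aleph0_le_card.2 (Ordinal.omega0_le_of_isSuccLimit hlim)
    choose! d hd hdc hL using fun α' (hα' : α' < α) =>
      ih α' hα' (hα'.le.trans hα) (e := e ∩ Iio (plus ρ α').ord)
        (fun x hx => ⟨(he hx.1).1, hx.2⟩)
        ((mk_le_mk_of_subset inter_subset_left).trans_lt hc)
    refine ⟨⋃ α' ∈ Iio α, d α', ?_, ?_, ?_⟩
    · refine iUnion₂_subset fun α' hα' => (hd α' hα').trans (inter_subset_inter_right _
        (Iio_subset_Iio (ord_le_ord.2 ((plus_strictMono ρ).monotone (le_of_lt hα')))))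
    -- Each piece has size less than `|α|⁺`, so at most `|α|`, and there are `|α|` pieces.
    · have h1 : #(⋃ α' ∈ Iio α, d α' : Set Ordinal.{u}) ≤ Cardinal.lift.{u + 1} α.card := by
        refine (mk_biUnion_le _ _).trans ?_
        rw [mk_Iio_ordinal]
        refine mul_le_of_le (by rwa [aleph0_le_lift]) le_rfl (ciSup_le' fun α' => ?_)
        have h2 := hdc α'.1 α'.2
        have h3 : max ℵ₀ (Order.succ α'.1.card) ≤ Order.succ α.card :=
          max_le (hω.trans (Order.le_succ _))
            (Order.succ_le_succ (Ordinal.card_le_card (le_of_lt α'.2)))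
        have h4 := h2.trans_le (lift_le.2 h3)
        rw [lift_succ] at h4
        exact Order.lt_succ_iff.1 h4
      refine h1.trans_lt (lift_lt.2 ?_)
      exact (Order.lt_succ _).trans_le (le_max_right _ _)
    · intro x hx
      obtain ⟨α', hα', hxα⟩ := exists_lt_plus_of_isSuccLimit hlim (he hx).2
      obtain ⟨L, hLd, h⟩ := hL α' hα' x ⟨hx, hxα⟩
      exact ⟨L, fun ξ hξ => mem_biUnion (show α' ∈ Iio α from hα') (hLd ξ hξ), h⟩

theorem exists_injOn_Iio_ord {c : Cardinal.{u}} (hc : 0 < c) {d : Set Ordinal.{u}}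
    (hd : #d < Cardinal.lift.{u + 1} c) : ∃ i : Ordinal.{u} → Iio c.ord, InjOn i d := by
  rw [← mk_Iio_ord] at hd
  obtain ⟨f⟩ := hd.le
  classical
  have h0 : (0 : Ordinal.{u}) < c.ord := by rwa [lt_ord, Ordinal.card_zero]
  refine ⟨fun x => if h : x ∈ d then f ⟨x, h⟩ else ⟨0, h0⟩, fun x hx y hy hxy => ?_⟩
  simp only [hx, hy, dif_pos] at hxy
  simpa using f.injective hxy

theorem exists_list_coding {ρ c : Cardinal.{u}} (hc : ℵ₀ ≤ c) (hcρ : c ≤ ρ) :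
    ∃ G : List (Iio c.ord) → Ordinal.{u} → Ordinal.{u}, (∀ l, ∀ y < ρ.ord, G l y < ρ.ord) ∧
      ∀ l l', ∀ y < ρ.ord, ∀ y' < ρ.ord, G l y = G l' y' → l = l' ∧ y = y' := by
  have hinf : Infinite (Iio c.ord) := by
    rw [infinite_iff, mk_Iio_ord, aleph0_le_lift]; exact hc
  have hle : #(List (Iio c.ord) × Iio ρ.ord) ≤ #(Iio ρ.ord) := by
    rw [mk_prod, lift_id, lift_id, mk_list_eq_mk, mk_Iio_ord, mk_Iio_ord]
    exact mul_le_of_le (by rw [aleph0_le_lift]; exact hc.trans hcρ) (lift_le.2 hcρ) le_rfl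
  obtain ⟨f⟩ := hle
  classical
  refine ⟨fun l y => if h : y < ρ.ord then (f (l, ⟨y, h⟩)).1 else 0, fun l y hy => ?_,
    fun l l' y hy y' hy' h => ?_⟩
  · simp only [hy, dif_pos]
    exact (f (l, ⟨y, hy⟩)).2
  · simp only [hy, hy', dif_pos] at h
    obtain ⟨h1, h2⟩ := Prod.mk.inj (f.injective (Subtype.ext h))
    exact ⟨h1, congrArg Subtype.val h2⟩

theorem list_map_injOn {α β : Type*} {f : α → β} {s : Set α} (hf : InjOn f s) {L L' : List α}
    (hL : ∀ x ∈ L, x ∈ s) (hL' : ∀ x ∈ L', x ∈ s) (h : L.map f = L'.map f) : L = L' := by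
  induction L generalizing L' with
  | nil => simpa using h.symm
  | cons x L ih =>
    cases L' with
    | nil => simp at h
    | cons x' L' =>
      simp only [List.map_cons, List.cons.injEq] at h
      rw [hf (hL x (by simp)) (hL' x' (by simp)) h.1,
        ih (fun z hz => hL z (by simp [hz])) (fun z hz => hL' z (by simp [hz])) h.2]

theorem DiagClosed.plus_of_cof (hκ : κ.IsRegular) (hlam : κ ≤ lam) (hF : IsFineFilter κ lam F)
    {ρ : Cardinal.{u}} {β : Ordinal.{u}} (hκρ : κ ≤ ρ) (hβ : max ℵ₀ (Order.succ β.card) < κ)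
    (hδ : (plus ρ β).ord ≤ lam.ord)
    (h1 : DiagClosed F (max ℵ₀ (Order.succ β.card)) (plus ρ β).ord)
    (h2 : DiagClosed F t ρ.ord) (ht2 : 2 ≤ t)
    (hcof : ∀ᶠ a in F, ∀ α < β, cup a t.ord ≤ (cup a (plus ρ (α + 1)).ord).cof.ord) :
    DiagClosed F t (plus ρ β).ord := by
  intro P hP
  set δ := (plus ρ β).ord with hδdef
  set c := max ℵ₀ (Order.succ β.card) with hcdef
  have hω : ℵ₀ ≤ c := le_max_left _ _
  have hc2 : 2 ≤ c := (natCast_lt_aleph0 (n := 2)).le.trans hω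
  have hc0 : 0 < c := aleph0_pos.trans_le hω
  choose g hg using exists_surjOn_card_ord.{u}
  choose! f hf hgf using hg
  obtain ⟨G, hGρ, hG⟩ := exists_list_coding hω (hβ.le.trans hκρ)
  -- The injection of `d` into `c` is fixed for each `d` before `a` and `e` are chosen, so that
  -- decoding depends only on the code.
  have hi : ∀ d : Set Ordinal.{u}, ∃ i : Ordinal.{u} → Iio c.ord,
      #d < Cardinal.lift.{u + 1} c → InjOn i d := fun d => by
    by_cases hd : #d < Cardinal.lift.{u + 1} c
    · obtain ⟨i, hi⟩ := exists_injOn_Iio_ord hc0 hd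
      exact ⟨i, fun _ => hi⟩
    · exact ⟨fun _ => ⟨0, by rwa [mem_Iio, lt_ord, Ordinal.card_zero]⟩, fun h => absurd h hd⟩
  choose i hi using hi
  let Dec : Set Ordinal.{u} → Set Ordinal.{u} → Set Ordinal.{u} := fun d w =>
    {x | ∃ L : List Ordinal.{u}, (∀ ξ ∈ L, ξ ∈ d) ∧
      ∃ y < ρ.ord, G (L.map (i d)) y ∈ w ∧ L.foldr g y = x}
  -- Two nested diagonal intersections: over the set `d` of bounds in `δ`, and, for fixed `d`, over
  -- the coded set `w ⊆ ρ`. The condition on `Dec d w` discards codes that decode to no legitimate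
  -- index.
  have hDec := h1 (fun d a => ∀ w ⊆ a ∩ Iio ρ.ord, #w < #(a ∩ Iio t.ord : Set Ordinal.{u}) →
    Dec d w ∈ Ptd t δ → P (Dec d w) a) fun d _ =>
      h2 (fun w a => Dec d w ∈ Ptd t δ → P (Dec d w) a) fun w _ => by
        by_cases h : Dec d w ∈ Ptd t δ
        · filter_upwards [hP _ h] with a ha _ using ha
        · exact Eventually.of_forall fun a h' => absurd h' h
  have hρδ : ρ.ord ≤ δ := ord_le_ord.2 (le_plus ρ β)
  have hfa : ∀ᶠ a in F, ∀ ξ ∈ a, ξ < δ → ∀ x ∈ a, x < δ → x < ξ → f ξ x ∈ a := by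
    refine h1.eventually_forall_mem hκ hlam hF hc2 fun ξ hξ =>
      h1.eventually_forall_mem hκ hlam hF hc2 fun x hx => ?_
    by_cases hxξ : x < ξ
    · filter_upwards [hF.fine (f ξ x) (((hf ξ x hxξ).trans_le (ord_card_le ξ)).trans
        (hξ.trans_le hδ))] with a ha _ using ha
    · exact Eventually.of_forall fun a h => absurd h hxξ
  -- There are only `c < κ` lists, so almost every `a` is closed under all the maps `G l` at once,
  -- and the code of `e` is a subset of `a`.
  have hGa : ∀ᶠ a in F, ∀ y ∈ a, y < ρ.ord → range (fun l => G l y) ⊆ a := by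
    refine h2.eventually_closed hκ hlam hF ht2 fun y hy => ⟨?_, ?_⟩
    · rintro _ ⟨l, rfl⟩
      exact (hGρ l y hy).trans_le (hρδ.trans hδ)
    · have hinf : Infinite (Iio c.ord) := by
        rw [infinite_iff, mk_Iio_ord, aleph0_le_lift]; exact hω
      refine mk_range_le.trans_lt ?_
      rw [mk_list_eq_mk, mk_Iio_ord]
      exact lift_lt.2 hβ
  filter_upwards [hDec, hfa, hGa, hcof, h1.eventually_add_one_mem hκ hlam hF hc2 hδ,
    hF.fine 0 (zero_lt_ord hκ hlam),
    hF.eventually_Iio_subset hlam (o := c.ord) (by rwa [card_ord])]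
    with a hDec hfa hGa hcof hs h0 hca e he hec
  have hαδ : ∀ α < β, (plus ρ (α + 1)).ord ≤ δ := fun α hα =>
    ord_le_ord.2 ((plus_strictMono ρ).monotone (Order.succ_le_of_lt hα))
  obtain ⟨d, hd, hdc, hL⟩ := exists_descent (g := g) (a := a) (β := β) (ρ := ρ)
    (c := #(a ∩ Iio t.ord : Set Ordinal.{u}))
    (fun ξ hξ hξδ x hx hxξ => ⟨f ξ x, hfa ξ hξ hξδ x hx (hxξ.trans hξδ) hxξ, hf ξ x hxξ,
      hgf ξ x hxξ⟩)
    (fun α hα e he hec => by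
      have hlim := isSuccLimit_ord
        (isRegular_plus_add_one (hκ.aleph0_le.trans hκρ) α).aleph0_le
      exact exists_bound_of_mk_lt ⟨0, h0, hlim.bot_lt⟩
        (fun x hx hxη => ⟨x + 1, hs x hx (hxη.trans_le (hαδ α hα)), hlim.succ_lt hxη,
          Order.lt_succ x⟩) (hcof α hα) he hec) β le_rfl he hec
  choose! L hLd y hya hyρ hfold using hL
  have hinj := hi d hdc
  -- Injectivity of `G`, together with that of `i d` on `d`, makes decoding return exactly `e`.
  have hDe : Dec d ((fun x => G ((L x).map (i d)) (y x)) '' e) = e := by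
    ext x
    constructor
    · rintro ⟨L', hL', y', hy', ⟨x', hx', hGx⟩, rfl⟩
      obtain ⟨hl, hyy⟩ := hG _ _ _ (hyρ x' hx') _ hy' hGx
      have hLL := list_map_injOn hinj (hLd x' hx') hL' hl
      rw [← hLL, ← hyy, hfold x' hx']
      exact hx'
    · exact fun hx => ⟨L x, hLd x hx, y x, hyρ x hx, mem_image_of_mem _ hx, hfold x hx⟩
  have := hDec d hd (hdc.trans_le (le_mk_inter_Iio_ord hca le_rfl))
    ((fun x => G ((L x).map (i d)) (y x)) '' e) (by
      rintro _ ⟨x, hx, rfl⟩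
      exact ⟨hGa (y x) (hya x hx) (hyρ x hx) (mem_range_self _), hGρ _ _ (hyρ x hx)⟩)
    (mk_image_le.trans_lt hec)
  rw [hDe] at this
  exact this (Ptd_of_subset he hec)

/-! ### Closure below `κ`, and transfer between `δ` and `|δ|` -/

/-- Otherwise `κ` injects into `P_t(ξ)` by some `f`, and almost every `a` contains `γ + 1` whenever
`f γ` is an admissible index for `a`. Once `ξ ⊆ a`, every `f γ` is admissible; `γ = sup (a ∩ κ)`
gives a contradiction. -/
theorem DiagClosed.mk_Ptd_lt (hκ : κ.IsRegular) (hlam : κ ≤ lam) (hF : IsFineFilter κ lam F)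
    (h : DiagClosed F t κ.ord) (ht : t ≤ κ) (hlim : t = κ → ∀ μ < κ, Order.succ μ < κ)
    {ξ : Ordinal.{u}} (hξ : ξ < κ.ord) : #(Ptd t ξ) < Cardinal.lift.{u + 1} κ := by
  by_contra! hle
  rw [← mk_Iio_ord] at hle
  obtain ⟨f⟩ := hle
  have hκlim := isSuccLimit_ord hκ.aleph0_le
  have hκlam := ord_le_ord.2 hlam
  have hP := h (fun e a => ∀ γ (hγ : γ < κ.ord), (f ⟨γ, hγ⟩).1 = e → γ + 1 ∈ a) fun e _ => by
    by_cases he : ∃ γ : Iio κ.ord, (f γ).1 = e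
    · obtain ⟨γ, rfl⟩ := he
      filter_upwards [hF.fine (γ.1 + 1) ((hκlim.succ_lt γ.2).trans_le hκlam)] with a ha γ' hγ' hff
      rw [← f.injective (Subtype.ext hff)] at ha
      exact ha
    · exact Eventually.of_forall fun a γ hγ h => absurd ⟨_, h⟩ he
  have hbig : ∀ᶠ a in F, ∀ e ∈ Ptd t ξ, #e < #(a ∩ Iio t.ord : Set Ordinal.{u}) := by
    rcases ht.lt_or_eq with htκ | htκ
    · filter_upwards [hF.eventually_Iio_subset hlam (o := t.ord) (by rwa [card_ord])] with a ha e he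
      exact he.2.trans_le (le_mk_inter_Iio_ord ha le_rfl)
    · filter_upwards [hF.eventually_lt_mk hlam ht hlim (μ := ξ.card)
        (by rw [htκ]; exact lt_ord.1 hξ)] with a ha e he
      refine lt_of_le_of_lt ((mk_le_mk_of_subset he.1).trans ?_) ha
      rw [mk_Iio_ordinal]
  have := hF.neBot
  obtain ⟨a, hP, hbig, hξa, haP⟩ := (hP.and (hbig.and
    ((hF.eventually_Iio_subset hlam (lt_ord.1 hξ)).and hF.mem_Pkl))).exists
  have hsup : cup a κ.ord < κ.ord := by
    refine Ordinal.sSup_lt_of_lt_cof ?_ inter_subset_right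
    rw [← Ordinal.lift_cof, hκ.cof_ord]
    exact (mk_le_mk_of_subset inter_subset_left).trans_lt haP.2
  have hmem := hP (f ⟨_, hsup⟩).1 (subset_inter ((f ⟨_, hsup⟩).2.1.trans hξa)
    ((f ⟨_, hsup⟩).2.1.trans (Iio_subset_Iio hξ.le))) (hbig _ (f ⟨_, hsup⟩).2) _ hsup rfl
  exact absurd (le_csSup (bddAbove_inter_Iio a κ.ord) ⟨hmem, hκlim.succ_lt hsup⟩)
    (not_le.2 (Order.lt_succ _))

theorem two_power_lt_of_mk_Ptd_lt (ht : t ≤ κ)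
    (h : ∀ ξ < κ.ord, #(Ptd t ξ) < Cardinal.lift.{u + 1} κ) {μ : Cardinal.{u}} (hμ : μ < t) :
    2 ^ μ < κ := by
  have hsub : 𝒫 (Iio μ.ord) ⊆ Ptd t μ.ord := fun e he =>
    ⟨he, (mk_le_mk_of_subset he).trans_lt (by rw [mk_Iio_ord]; exact lift_lt.2 hμ)⟩
  have := (mk_le_mk_of_subset hsub).trans_lt (h μ.ord (ord_lt_ord.2 (hμ.trans_le ht)))
  rw [mk_powerset, mk_Iio_ord, ← lift_two_power] at this
  exact lift_lt.1 this

/-- Every small `e ⊆ a ∩ κ` lies below some `ξ ∈ a ∩ κ`. Completeness of the filter intersects over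
all of `P_t(ξ)`, and a diagonal intersection over `ξ` finishes. -/
theorem DiagClosed.of_cof_of_mk_Ptd_lt (hκ : κ.IsRegular) (hlam : κ ≤ lam)
    (hF : IsFineFilter κ lam F) {t' : Cardinal.{u}} (h : DiagClosed F t' κ.ord) (ht' : 2 ≤ t')
    (hPtd : ∀ ξ < κ.ord, #(Ptd t ξ) < Cardinal.lift.{u + 1} κ)
    (hcof : ∀ᶠ a in F, cup a t.ord ≤ (cup a κ.ord).cof.ord) : DiagClosed F t κ.ord := by
  intro P hP
  have hκlim := isSuccLimit_ord hκ.aleph0_le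
  filter_upwards [h.eventually_forall_mem hκ hlam hF ht' fun ξ hξ =>
    hF.eventually_ball (p := fun a e => P e a) (hPtd ξ hξ) fun e he =>
      hP e (Ptd_mono le_rfl hξ.le he), hcof, hF.fine 0 (zero_lt_ord hκ hlam),
    h.eventually_add_one_mem hκ hlam hF ht' (ord_le_ord.2 hlam)] with a ha hcof h0 hs e he hc
  obtain ⟨ξ, hξ, hξκ, hlt⟩ := exists_bound_of_mk_lt ⟨0, h0, hκ.ord_pos⟩
    (fun x hx hxη => ⟨x + 1, hs x hx hxη, hκlim.succ_lt hxη, Order.lt_succ x⟩) hcof he hc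
  exact ha ξ hξ hξκ e ⟨hlt, (Ptd_of_subset he hc).2⟩

theorem DiagClosed.of_card (hκ : κ.IsRegular) (hlam : κ ≤ lam)
    (hF : IsFineFilter κ lam F) {t' : Cardinal.{u}} (h : DiagClosed F t' δ) (ht' : 2 ≤ t')
    (hδ : δ ≤ lam.ord) (hcard : DiagClosed F t δ.card.ord) : DiagClosed F t δ := by
  intro P hP
  obtain ⟨g, hg⟩ := exists_surjOn_card_ord δ
  choose! f hf hgf using hg
  filter_upwards [hcard (fun w a => g '' w ∈ Ptd t δ → P (g '' w) a) fun w _ => by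
      by_cases hw : g '' w ∈ Ptd t δ
      · filter_upwards [hP _ hw] with a ha _ using ha
      · exact Eventually.of_forall fun a h => absurd h hw,
    h.eventually_forall_mem hκ hlam hF ht' fun x hx =>
      hF.fine (f x) ((hf x hx).trans_le ((ord_card_le δ).trans hδ))] with a ha hfa e he hc
  have hge : g '' (f '' e) = e := by
    rw [image_image]
    refine (image_congr fun x hx => ?_).trans (image_id e)
    exact hgf x (he hx).2
  have := ha (f '' e) (by
    rintro _ ⟨x, hx, rfl⟩
    exact ⟨hfa x (he hx).1 (he hx).2, hf x (he hx).2⟩) (mk_image_le.trans_lt hc)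
  rw [hge] at this
  exact this (Ptd_of_subset he hc)

/-! ### The least normal ideal -/

theorem mem_Ikl_iff {B : Set (Set Ordinal.{u})} :
    B ∈ Ikl κ lam ↔ B ⊆ Pkl κ lam ∧ ∃ c ∈ Pkl κ lam, ∀ b ∈ B, ¬ c ⊆ b := by
  refine and_congr_right fun hB => exists_congr fun c => and_congr_right fun _ => ?_
  rw [Set.eq_empty_iff_forall_notMem]
  exact ⟨fun h b hb hc => h b ⟨hb, hB hb, hc⟩, fun h b hb => h b hb.1 hb.2.2⟩

theorem sUnion_mem_Ikl (hκ : κ.IsRegular) {Y : Set (Set (Set Ordinal.{u}))} (hY : Y ⊆ Ikl κ lam)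
    (hc : #Y < Cardinal.lift.{u + 1} κ) : ⋃₀ Y ∈ Ikl κ lam := by
  choose! c hcP hcB using fun B (hB : B ∈ Y) => (mem_Ikl_iff.1 (hY hB)).2
  refine mem_Ikl_iff.2 ⟨sUnion_subset fun B hB => (hY hB).1, ⋃ B ∈ Y, c B,
    biUnion_mem_Pkl hκ hc hcP, ?_⟩
  rintro b ⟨B, hB, hb⟩ hsub
  exact hcB B hB b hb ((subset_biUnion_of_mem hB).trans hsub)

theorem nabla_subset_Pkl {K : Set (Set (Set Ordinal.{u}))} {B : Set (Set Ordinal.{u})}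
    (hB : B ∈ nabla κ lam θ δ K) : B ⊆ Pkl κ lam := by
  obtain ⟨X, -, hB⟩ := hB
  intro a ha
  rcases hB ha with h | h
  · exact h.1
  · obtain ⟨e, -, -, h, -⟩ := mem_iUnion₂.1 h
    exact h

theorem isIdealOn_nabla_Ikl (hκ : κ.IsRegular) (hθ : θ ≠ 0) {K : Set (Set (Set Ordinal.{u}))}
    (hK : IsIdealOn κ lam K) (hsub : nabla κ lam θ δ (Ikl κ lam) ⊆ K) :
    IsIdealOn κ lam (nabla κ lam θ δ (Ikl κ lam)) where
  subset_Pkl _ hB := nabla_subset_Pkl hB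
  mem_of_subset := fun _ ⟨X, hX, hB⟩ _ hB' => ⟨X, hX, hB'.trans hB⟩
  sUnion_mem := by
    intro Y hY _ hc
    rw [hκ.cof_ord] at hc
    choose! X hX hB using fun B (hB : B ∈ Y) => hY hB
    refine ⟨fun e => ⋃₀ ((fun B => X B e) '' Y), fun e he => ?_, ?_⟩
    · refine sUnion_mem_Ikl hκ ?_ (mk_image_le.trans_lt hc)
      rintro _ ⟨B, hB, rfl⟩
      exact hX B hB e he
    · rintro a ⟨B, hBY, ha⟩
      rcases hB B hBY ha with h | h
      · exact Or.inl h
      · obtain ⟨e, he, hXe, h⟩ := mem_iUnion₂.1 h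
        exact Or.inr (mem_iUnion₂.2 ⟨e, he, ⟨_, mem_image_of_mem _ hBY, hXe⟩, h⟩)
  Ikl_subset := subset_nabla hθ fun _ hB => hB.1
  Pkl_notMem h := hK.Pkl_notMem (hsub h)

/-- Members of the ideal are sets of `a` that fail to be closed under some function `c`. The set `s`
serves as a base that `a` may be assumed to include: failures of `s ⊆ a` are absorbed by enlarging
each `c e` to `c e ∪ s`. -/
theorem mem_nabla_Ikl_iff (hκ : κ.IsRegular) (hθ : θ ≠ 0) {s : Set Ordinal.{u}}
    (hs : s ∈ Pkl κ lam) (h0 : 0 ∈ s) {B : Set (Set Ordinal.{u})} :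
    B ∈ nabla κ lam θ δ (Ikl κ lam) ↔ B ⊆ Pkl κ lam ∧
      ∃ c : Set Ordinal.{u} → Set Ordinal.{u}, (∀ e ∈ Ptd θ δ, c e ∈ Pkl κ lam) ∧
        ∀ a ∈ B, s ⊆ a → ∃ e ⊆ a ∩ Iio δ, #e < #(a ∩ Iio θ.ord : Set Ordinal.{u}) ∧
          ¬ c e ⊆ a := by
  have hθ0 : (0 : Ordinal.{u}) < θ.ord := by
    rw [lt_ord, Ordinal.card_zero, pos_iff_ne_zero]; exact hθ
  constructor
  · intro h
    refine ⟨nabla_subset_Pkl h, ?_⟩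
    obtain ⟨X, hX, hB⟩ := h
    choose! c hcP hcX using fun e he => (mem_Ikl_iff.1 (hX e he)).2
    refine ⟨c, hcP, fun a ha hsa => ?_⟩
    rcases hB ha with ⟨-, h⟩ | h
    · have : (0 : Ordinal.{u}) ∈ a ∩ Iio θ.ord := ⟨hsa h0, hθ0⟩
      simp [h] at this
    · obtain ⟨e, he, hXe, -, hea, hec⟩ := mem_iUnion₂.1 h
      exact ⟨e, hea, hec, hcX e he a hXe⟩
  · rintro ⟨hBP, c, hc, hB⟩
    refine ⟨fun e => {a | a ∈ Pkl κ lam ∧ ¬ c e ∪ s ⊆ a}, fun e he =>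
      mem_Ikl_iff.2 ⟨fun a ha => ha.1, _, union_mem_Pkl hκ (hc e he) hs, fun b hb => hb.2⟩, ?_⟩
    intro a ha
    by_cases hne : a ∩ Iio θ.ord = ∅
    · exact Or.inl ⟨hBP ha, hne⟩
    refine Or.inr (mem_iUnion₂.2 ?_)
    by_cases hsa : s ⊆ a
    · obtain ⟨e, he, hec, hn⟩ := hB a ha hsa
      exact ⟨e, Ptd_of_subset he hec, ⟨hBP ha, fun h => hn (subset_union_left.trans h)⟩, hBP ha,
        he, hec⟩
    · have hec : #(∅ : Set Ordinal.{u}) < #(a ∩ Iio θ.ord : Set Ordinal.{u}) := by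
        rw [mk_eq_zero, pos_iff_ne_zero, mk_ne_zero_iff]
        exact (nonempty_iff_ne_empty.2 hne).to_subtype
      exact ⟨∅, Ptd_of_subset (empty_subset _) hec,
        ⟨hBP ha, fun h => hsa (subset_union_right.trans h)⟩, hBP ha, empty_subset _, hec⟩

/-- Two successive witnesses `e` and `e'` are merged into `e ∪ e'`, still small because `a ∩ t` is
infinite. As the union does not remember its two parts, the new function at `u` takes in all pairs
of subsets of `u`, fewer than `κ` by the power hypothesis. -/
theorem nabla_nabla_Ikl_subset (hκ : κ.IsRegular) (hlam : κ ≤ lam) (hω : ℵ₀ < κ) (ht : ℵ₀ ≤ t)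
    (hpow : ∀ μ < t, 2 ^ μ < κ) :
    nabla κ lam t δ (nabla κ lam t δ (Ikl κ lam)) ⊆ nabla κ lam t δ (Ikl κ lam) := by
  have ht0 : t ≠ 0 := (aleph0_pos.trans_le ht).ne'
  have hs : Iio (ℵ₀ : Cardinal.{u}).ord ∈ Pkl κ lam := Iio_subset_mem_Pkl (by rwa [card_ord]) hlam
  have h0 : (0 : Ordinal.{u}) ∈ Iio (ℵ₀ : Cardinal.{u}).ord := isRegular_aleph0.ord_pos
  intro B hB
  rw [mem_nabla_Ikl_iff hκ ht0 hs h0]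
  refine ⟨nabla_subset_Pkl hB, ?_⟩
  obtain ⟨X, hX, hB⟩ := hB
  choose! c hcP hcX using fun e he => ((mem_nabla_Ikl_iff hκ ht0 hs h0).1 (hX e he)).2
  have hsubset : ∀ u ∈ Ptd t δ, ∀ e ∈ 𝒫 u, e ∈ Ptd t δ := fun u hu e he =>
    ⟨Subset.trans he hu.1, (mk_le_mk_of_subset he).trans_lt hu.2⟩
  refine ⟨fun u => ⋃ e ∈ 𝒫 u, ⋃ e' ∈ 𝒫 u, c e e', fun u hu => ?_, fun a ha hsa => ?_⟩
  · have hcard : #(𝒫 u) < Cardinal.lift.{u + 1} κ := by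
      obtain ⟨μ, hμ, hμu⟩ := lt_lift_iff.1 (show #u < Cardinal.lift.{u + 1} t from hu.2)
      rw [mk_powerset, ← hμu, ← lift_two_power]
      exact lift_lt.2 (hpow μ hμ)
    exact biUnion_mem_Pkl hκ hcard fun e he => biUnion_mem_Pkl hκ hcard fun e' he' =>
      hcP e (hsubset u hu e he) e' (hsubset u hu e' he')
  · have hinf : ℵ₀ ≤ #(a ∩ Iio t.ord : Set Ordinal.{u}) := by
      simpa using le_mk_inter_Iio_ord hsa ht
    rcases hB ha with ⟨-, h⟩ | h
    · have : (0 : Ordinal.{u}) ∈ a ∩ Iio t.ord := ⟨hsa h0, Iio_subset_Iio (ord_le_ord.2 ht) h0⟩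
      simp [h] at this
    · obtain ⟨e, he, hXe, -, hea, hec⟩ := mem_iUnion₂.1 h
      obtain ⟨e', he'a, he'c, hn⟩ := hcX e he a hXe hsa
      refine ⟨e ∪ e', union_subset hea he'a,
        (mk_union_le _ _).trans_lt (add_lt_of_lt hinf hec he'c), fun h => hn ?_⟩
      refine Subset.trans ?_ h
      exact (subset_biUnion_of_mem (u := fun e' => c e e')
        (show e' ∈ 𝒫 (e ∪ e') from subset_union_right)).trans
        (subset_biUnion_of_mem (u := fun e => ⋃ e'' ∈ 𝒫 (_ ∪ e'), c e e'')
          (show e ∈ 𝒫 (e ∪ e') from subset_union_left))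

theorem nabla_Ikl_mono (hκ : κ.IsRegular) (hlam : κ ≤ lam) {t' : Cardinal.{u}} (ht' : t' ≠ 0)
    (h : t' ≤ t) : nabla κ lam t' δ (Ikl κ lam) ⊆ nabla κ lam t δ (Ikl κ lam) := by
  have ht : t ≠ 0 := fun h0 => ht' (nonpos_iff_eq_zero.1 (h.trans_eq h0))
  have hs : {0} ∈ Pkl κ lam := singleton_mem_Pkl hκ (zero_lt_ord hκ hlam)
  intro B hB
  rw [mem_nabla_Ikl_iff hκ ht' hs rfl] at hB
  rw [mem_nabla_Ikl_iff hκ ht hs rfl]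
  obtain ⟨hBP, c, hc, hB⟩ := hB
  classical
  refine ⟨hBP, fun e => if e ∈ Ptd t' δ then c e else ∅, fun e _ => ?_, fun a ha hsa => ?_⟩
  · dsimp only
    split_ifs with he
    · exact hc e he
    · exact empty_mem_Pkl hκ
  · obtain ⟨e, he, hec, hn⟩ := hB a ha hsa
    refine ⟨e, he, hec.trans_le (mk_le_mk_of_subset (inter_subset_inter_right _
      (Iio_subset_Iio (ord_le_ord.2 h)))), ?_⟩
    dsimp only
    rwa [if_pos (Ptd_of_subset he hec)]

theorem exists_coding_Ptd_aleph0 (hδ : ℵ₀ ≤ δ.card) :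
    ∃ (j : Set Ordinal.{u} → Ordinal.{u}) (k : Ordinal.{u} → Set Ordinal.{u}),
      (∀ s ∈ Ptd ℵ₀ δ, j s < δ) ∧ (∀ z, k z ∈ Ptd ℵ₀ δ) ∧ ∀ s ∈ Ptd ℵ₀ δ, k (j s) = s := by
  have hinf : Infinite (Iio δ) := by
    rw [infinite_iff, mk_Iio_ordinal, aleph0_le_lift]; exact hδ
  have hfin : ∀ s ∈ Ptd ℵ₀ δ, s.Finite := fun s hs => by
    have : #s < Cardinal.lift.{u + 1} ℵ₀ := hs.2
    rw [lift_aleph0] at this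
    exact lt_aleph0_iff_set_finite.1 this
  have hle : #(Ptd ℵ₀ δ) ≤ #(Iio δ) := by
    rw [← mk_finset_of_infinite (Iio δ)]
    refine mk_le_of_injective (f := fun s => ((hfin s.1 s.2).preimage
      (f := fun x : Iio δ => x.1) Subtype.val_injective.injOn).toFinset) fun s s' h => ?_
    have h1 : (fun x : Iio δ => x.1) ⁻¹' s.1 = (fun x : Iio δ => x.1) ⁻¹' s'.1 := by
      simpa using h
    refine Subtype.ext (Set.ext fun x => ⟨fun hx => ?_, fun hx => ?_⟩)
    · exact h1.subset (show (⟨x, s.2.1 hx⟩ : Iio δ) ∈ _ from hx)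
    · exact h1.superset (show (⟨x, s'.2.1 hx⟩ : Iio δ) ∈ _ from hx)
  obtain ⟨f⟩ := hle
  have h0 : (∅ : Set Ordinal.{u}) ∈ Ptd ℵ₀ δ := ⟨empty_subset _, by simpa using aleph0_pos⟩
  classical
  refine ⟨fun s => if hs : s ∈ Ptd ℵ₀ δ then (f ⟨s, hs⟩).1 else 0,
    fun z => if hz : ∃ s, (f s).1 = z then hz.choose.1 else ∅, fun s hs => ?_, fun z => ?_,
    fun s hs => ?_⟩
  · simp only [hs, dif_pos]
    exact (f ⟨s, hs⟩).2
  · dsimp only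
    split_ifs with hz
    · exact hz.choose.2
    · exact h0
  · have hz : ∃ s', (f s').1 = (f ⟨s, hs⟩).1 := ⟨_, rfl⟩
    simp only [hs, dif_pos]
    rw [dif_pos hz, f.injective (Subtype.ext hz.choose_spec)]

/-- Finite subsets of `δ` are coded by ordinals below `δ`. Adjoining one element is an operation on
the pair (element, code), so index sets with at most two elements already generate all finite ones.
This is the role of the factor `3` in `NS`. -/
theorem nabla_Ikl_eq_of_three_le (hκ : κ.IsRegular) (hlam : κ ≤ lam) (hω : ℵ₀ < κ)
    (hδω : ℵ₀ ≤ δ.card) (hδ : δ ≤ lam.ord) (ht3 : 3 ≤ t) (ht : t ≤ ℵ₀) :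
    nabla κ lam t δ (Ikl κ lam) = nabla κ lam ℵ₀ δ (Ikl κ lam) := by
  have ht0 : t ≠ 0 := by rintro rfl; simp at ht3
  refine (nabla_Ikl_mono hκ hlam ht0 ht).antisymm ?_
  have hs : Iio (ℵ₀ : Cardinal.{u}).ord ∈ Pkl κ lam := Iio_subset_mem_Pkl (by rwa [card_ord]) hlam
  have h0 : (0 : Ordinal.{u}) ∈ Iio (ℵ₀ : Cardinal.{u}).ord := isRegular_aleph0.ord_pos
  intro B hB
  rw [mem_nabla_Ikl_iff hκ aleph0_ne_zero hs h0] at hB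
  rw [mem_nabla_Ikl_iff hκ ht0 hs h0]
  obtain ⟨hBP, c, hc, hB⟩ := hB
  obtain ⟨j, k, hj, hk, hkj⟩ := exists_coding_Ptd_aleph0 hδω
  have hfin : ∀ s : Set Ordinal.{u}, #s < Cardinal.lift.{u + 1} (ℵ₀ : Cardinal.{u}) ↔ s.Finite := fun s => by
    rw [lift_aleph0]; exact lt_aleph0_iff_set_finite
  have hins : ∀ x < δ, ∀ s ∈ Ptd ℵ₀ δ, insert x s ∈ Ptd ℵ₀ δ := fun x hx s hs =>
    ⟨insert_subset hx hs.1, (hfin _).2 (((hfin s).1 hs.2).insert x)⟩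
  have hempty : (∅ : Set Ordinal.{u}) ∈ Ptd ℵ₀ δ := ⟨empty_subset _, by simpa using aleph0_pos⟩
  refine ⟨hBP, fun u => {j ∅} ∪ ⋃ x ∈ u, ⋃ z ∈ u, ({j (insert x (k z))} ∪ c (k z)),
    fun u hu => ?_, fun a ha hsa => ?_⟩
  · have hcard : #u < Cardinal.lift.{u + 1} κ := hu.2.trans (lift_lt.2 (ht.trans_lt hω))
    refine union_mem_Pkl hκ (singleton_mem_Pkl hκ ((hj _ hempty).trans_le hδ))
      (biUnion_mem_Pkl hκ hcard fun x hx => biUnion_mem_Pkl hκ hcard fun z hz =>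
        union_mem_Pkl hκ (singleton_mem_Pkl hκ ((hj _ (hins x (hu.1 hx) _ (hk z))).trans_le hδ))
          (hc _ (hk z)))
  · by_contra! hcl
    have h3 : 3 ≤ #(a ∩ Iio t.ord : Set Ordinal.{u}) := by
      have := le_mk_inter_Iio_ord (c := 3) (a := a) (d := t) (Subset.trans (Iio_subset_Iio
        (ord_le_ord.2 (natCast_lt_aleph0 (n := 3)).le)) hsa) ht3
      simpa using this
    have hpair : ∀ x ∈ a, x < δ → ∀ z ∈ a, z < δ →
        j ∅ ∈ a ∧ j (insert x (k z)) ∈ a ∧ c (k z) ⊆ a := by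
      intro x hx hxδ z hz hzδ
      have hsub := hcl {x, z} (by
        rintro w (rfl | rfl)
        · exact ⟨hx, hxδ⟩
        · exact ⟨hz, hzδ⟩) (by
        refine lt_of_lt_of_le (mk_insert_le.trans_lt ?_) h3
        rw [mk_singleton]
        norm_num)
      obtain ⟨h1, h2⟩ := union_subset_iff.1 hsub
      rw [iUnion₂_subset_iff] at h2
      have h4 := iUnion₂_subset_iff.1 (h2 x (mem_insert _ _)) z (mem_insert_of_mem _ rfl)
      obtain ⟨h5, h6⟩ := union_subset_iff.1 h4
      exact ⟨h1 rfl, h5 rfl, h6⟩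
    have h0δ : (0 : Ordinal.{u}) < δ := by
      rw [pos_iff_ne_zero]
      rintro rfl
      rw [Ordinal.card_zero] at hδω
      exact absurd hδω (not_le.2 aleph0_pos)
    have hj0 : j ∅ ∈ a := (hpair 0 (hsa h0) h0δ 0 (hsa h0) h0δ).1
    have hja : ∀ s : Set Ordinal.{u}, s.Finite → s ⊆ a ∩ Iio δ → j s ∈ a := by
      intro s hs
      induction s, hs using Set.Finite.induction_on with
      | empty => exact fun _ => hj0
      | @insert x s _ hsf ih =>
        intro hxs
        have hsub := (subset_insert x s).trans hxs
        have hsP : s ∈ Ptd ℵ₀ δ := ⟨hsub.trans inter_subset_right, (hfin s).2 hsf⟩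
        have hxa := hxs (mem_insert x s)
        have := (hpair x hxa.1 hxa.2 (j s) (ih hsub) (hj s hsP)).2.1
        rwa [hkj s hsP] at this
    obtain ⟨e, he, hec, hn⟩ := hB a ha hsa
    have heP := Ptd_of_subset he hec
    have hje := hja e ((hfin e).1 heP.2) he
    -- The index pair degenerates to `{j e}`; only the component `c (k (j e)) = c e` is needed.
    have := (hpair _ hje (hj e heP) _ hje (hj e heP)).2.2
    rw [hkj e heP] at this
    exact hn this

theorem NS_eq_nabla (hκ : κ.IsRegular) (hlam : κ ≤ lam) (hω : ℵ₀ < κ) (hκδ : κ.ord ≤ δ)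
    (hδ : δ ≤ lam.ord) (hθ : 2 ≤ θ) :
    NS κ lam θ δ = nabla κ lam (max ℵ₀ (thetaBar κ θ)) δ (Ikl κ lam) := by
  have h2 := two_le_thetaBar hκ hθ
  have h3 : (3 : Cardinal.{u}) ≤ ℵ₀ := (natCast_lt_aleph0 (n := 3)).le
  rcases le_total ℵ₀ (thetaBar κ θ) with h | h
  · rw [NS, max_eq_right h, mul_eq_left h (h3.trans h) (by simp)]
  · rw [NS, max_eq_left h]
    refine nabla_Ikl_eq_of_three_le hκ hlam hω (hω.le.trans (ord_le.1 hκδ)) hδ ?_ ?_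
    · exact le_mul_of_one_le_left' (one_le_two.trans h2)
    · exact mul_le_of_le le_rfl h h3

/-! ### Restrictions -/

section

variable {K : Set (Set (Set Ordinal.{u}))} {C : Set (Set Ordinal.{u})}

theorem IsIdealOn.restrict (hK : IsIdealOn κ lam K)
    (hC : C ∈ positive κ lam K) : IsIdealOn κ lam (restrict κ lam K C) where
  subset_Pkl _ hB := hB.1
  mem_of_subset B hB B' hB' :=
    ⟨hB'.trans hB.1, hK.mem_of_subset _ hB.2 _ (inter_subset_inter_left _ hB')⟩
  sUnion_mem := by
    intro Y hY hne hc
    refine ⟨sUnion_subset fun B hB => (hY hB).1, ?_⟩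
    have := hK.sUnion_mem ((fun B => B ∩ C) '' Y) (by
      rintro _ ⟨B, hB, rfl⟩
      exact (hY hB).2) (hne.image _) (mk_image_le.trans_lt hc)
    rwa [sUnion_image, ← iUnion₂_inter, ← sUnion_eq_biUnion] at this
  Ikl_subset B hB := ⟨hB.1, hK.mem_of_subset _ (hK.Ikl_subset hB) _ inter_subset_left⟩
  Pkl_notMem h := hC.2 (by
    have := h.2
    rwa [inter_eq_self_of_subset_right hC.1] at this)

theorem IsIdealOn.eventually_ae_restrict (hκ : κ.IsRegular) (hK : IsIdealOn κ lam K)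
    (hC : C ∈ positive κ lam K) {p : Set Ordinal.{u} → Prop} :
    (∀ᶠ a in (hK.restrict hC).ae hκ, p a) ↔ ∀ᶠ a in hK.ae hκ, a ∈ C → p a := by
  have h : {a | a ∈ Pkl κ lam ∧ ¬ p a} ∩ C = {a | a ∈ Pkl κ lam ∧ ¬ (a ∈ C → p a)} := by
    ext a
    simp only [mem_inter_iff, mem_ofPred_eq]
    tauto
  rw [IsIdealOn.eventually_ae, IsIdealOn.eventually_ae, ← h]
  exact ⟨fun h => h.2, fun h => ⟨fun a ha => ha.1, h⟩⟩

theorem IsIdealOn.diagClosed_restrict (hκ : κ.IsRegular) (hK : IsIdealOn κ lam K)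
    (hC : C ∈ positive κ lam K) (h : DiagClosed (hK.ae hκ) t δ) :
    DiagClosed ((hK.restrict hC).ae hκ) t δ := by
  intro P hP
  rw [hK.eventually_ae_restrict hκ hC]
  filter_upwards [h (fun e a => a ∈ C → P e a) fun e he =>
    (hK.eventually_ae_restrict hκ hC).1 (hP e he)] with a ha haC e he hc
  exact ha e he hc haC

theorem IsIdealOn.notMem_of_eventually_mem (hκ : κ.IsRegular) (hK : IsIdealOn κ lam K)
    (h : ∀ᶠ a in hK.ae hκ, a ∈ C) : C ∉ K := by
  intro hCK
  have h' : ∀ᶠ a in hK.ae hκ, a ∉ C := by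
    rw [hK.eventually_ae hκ]
    exact hK.mem_of_subset _ hCK _ fun a ha => not_not.1 ha.2
  have := (hK.isFineFilter_ae hκ).neBot
  obtain ⟨a, ha, ha'⟩ := (h.and h').exists
  exact ha' ha

theorem IsIdealOn.restrict_subset (hκ : κ.IsRegular) (hK : IsIdealOn κ lam K)
    {K' : Set (Set (Set Ordinal.{u}))} (hK' : K' ⊆ K) (h : ∀ᶠ a in hK.ae hκ, a ∈ C) :
    PkLambda.restrict κ lam K' C ⊆ K := by
  rintro B ⟨hBP, hB⟩
  have h' : ∀ᶠ a in hK.ae hκ, a ∉ B ∩ C := by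
    rw [hK.eventually_ae hκ]
    exact hK.mem_of_subset _ (hK' hB) _ fun a ha => not_not.1 ha.2
  have h'' : ∀ᶠ a in hK.ae hκ, a ∉ B := by
    filter_upwards [h, h'] with a ha ha' haB using ha' ⟨haB, ha⟩
  rw [hK.eventually_ae hκ] at h''
  exact hK.mem_of_subset _ h'' _ fun a ha => ⟨hBP ha, not_not.2 ha⟩

end

/-! ### Characterizations of normality -/

theorem DiagClosed.eventually_cup_le_cof_plus (hκ : κ.IsRegular) (hlam : κ ≤ lam)
    (hF : IsFineFilter κ lam F) (h : DiagClosed F t δ) (ht2 : 2 ≤ t) (ht : t ≤ κ)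
    (hlim : t = κ → ∀ μ < κ, Order.succ μ < κ) {ρ : Cardinal.{u}} {β : Ordinal.{u}}
    (hκρ : κ ≤ ρ) (hβ : β.card < κ) (hβδ : (plus ρ β).ord ≤ δ) (hδ : δ ≤ lam.ord) :
    ∀ᶠ a in F, ∀ α < β, cup a t.ord ≤ (cup a (plus ρ (α + 1)).ord).cof.ord := by
  refine hF.eventually_ball (S := Iio β)
    (p := fun a α => cup a t.ord ≤ (cup a (plus ρ (α + 1)).ord).cof.ord)
    (by rw [mk_Iio_ordinal]; exact lift_lt.2 hβ) fun α hα => ?_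
  refine h.eventually_cup_le_cof hκ hlam hF ht2 ht hlim
    (isRegular_plus_add_one (hκ.aleph0_le.trans hκρ) α) (hκρ.trans (le_plus _ _)) ?_ hδ
  exact (ord_le_ord.2 ((plus_strictMono ρ).monotone (Order.succ_le_of_lt hα))).trans hβδ

theorem isNormal_plus_iff (hκ : κ.IsRegular) (hlam : κ ≤ lam) (hθ2 : 2 ≤ θ) (hθκ : θ ≤ κ)
    (hJ : IsIdealOn κ lam J) {ρ : Cardinal.{u}} {β : Ordinal.{u}} (hκρ : κ ≤ ρ) (hβ1 : 1 ≤ β)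
    (hβ : β < (thetaBar κ θ).ord) (hδ : (plus ρ β).ord ≤ lam.ord) :
    IsNormal κ lam θ (plus ρ β).ord J ↔
      IsNormal κ lam (Order.succ β.card) (plus ρ β).ord J ∧ IsNormal κ lam θ ρ.ord J ∧
        {a | a ∈ Aset κ lam ρ β ∧ ∀ α < β, CofGe κ θ a (plus ρ (α + 1)).ord} ∈
          dual κ lam J := by
  have hF := hJ.isFineFilter_ae hκ
  have ht2 := two_le_thetaBar hκ hθ2
  have htκ := (thetaBar_le κ θ).trans hθκ
  have hlim : thetaBar κ θ = κ → ∀ μ < κ, Order.succ μ < κ := fun h μ hμ =>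
    succ_lt_of_thetaBar_eq h hμ
  have hβt : β.card < thetaBar κ θ := lt_ord.1 hβ
  have hθ0 : θ ≠ 0 := (two_pos.trans_le hθ2).ne'
  have hβ2 : 2 ≤ Order.succ β.card := by
    have h1 : (1 : Cardinal.{u}) ≤ β.card := by simpa using Ordinal.card_le_card hβ1
    have h2 : Order.succ (1 : Cardinal.{u}) = 2 := by
      rw [← Nat.cast_one, succ_natCast, Nat.cast_one, one_add_one_eq_two]
    rw [← h2]
    exact Order.succ_le_succ h1
  have hβ0 : Order.succ β.card ≠ 0 := (two_pos.trans_le hβ2).ne'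
  have hρδ : ρ.ord ≤ (plus ρ β).ord := ord_le_ord.2 (le_plus ρ β)
  rw [hJ.isNormal_iff hκ hlam hθ0, hJ.isNormal_iff hκ hlam hβ0, hJ.isNormal_iff hκ hlam hθ0,
    ← diagClosed_thetaBar_iff hlam hF, ← diagClosed_thetaBar_iff (θ := θ) (δ := ρ.ord) hlam hF]
  constructor
  · intro h
    refine ⟨h.mono (Order.succ_le_of_lt hβt) le_rfl, h.mono le_rfl hρδ, fun a ha => ha.1.1, ?_⟩
    have hev : ∀ᶠ a in hJ.ae hκ, a ∈ Aset κ lam ρ β ∧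
        ∀ α < β, CofGe κ θ a (plus ρ (α + 1)).ord := by
      filter_upwards [hF.mem_Pkl, h.eventually_add_one_mem hκ hlam hF ht2 hδ,
        hF.eventually_ball (S := Iio β) (p := fun a γ => (plus ρ γ).ord ∈ a)
          (by rw [mk_Iio_ordinal]; exact lift_lt.2 (hβt.trans_le htκ)) fun γ hγ =>
            hF.fine _ ((ord_lt_ord.2 (plus_strictMono ρ hγ)).trans_le hδ),
        h.eventually_cup_le_cof_plus hκ hlam hF ht2 htκ hlim hκρ (hβt.trans_le htκ) le_rfl hδ]
        with a haP hs hγ hcof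
      exact ⟨⟨haP, fun α hα => hs α hα.1 hα.2.1, hγ⟩, hcof⟩
    exact (hJ.eventually_ae hκ).1 hev
  · rintro ⟨h1, h2, -, h3⟩
    have hω := h1.aleph0_lt hκ hlam hF hβ2 hδ ((ord_le_ord.2 hκρ).trans hρδ)
    -- `|β|⁺ < κ` holds either because `|β|⁺ ≤ θ̄ < κ`, or because `θ̄ = κ` makes `κ` a limit
    -- cardinal.
    refine DiagClosed.plus_of_cof hκ hlam hF hκρ (max_lt hω ?_) hδ
      ((diagClosed_max_aleph0_iff hκ hlam hF hβ2 hω).2 h1) h2 ht2 ?_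
    · rcases htκ.lt_or_eq with h | h
      · exact (Order.succ_le_of_lt hβt).trans_lt h
      · exact hlim h _ (h ▸ hβt)
    · have hev : ∀ᶠ a in hJ.ae hκ, a ∈ Aset κ lam ρ β ∧
          ∀ α < β, CofGe κ θ a (plus ρ (α + 1)).ord := (hJ.eventually_ae hκ).2 h3
      exact hev.mono fun a ha => ha.2

/-! ### The least normal ideal as a restriction -/

/-- The set of `a ∈ P_κ(λ)` such that `cf(∪(a ∩ κ)) ≥ ∪(a ∩ θ̄)` and
`cf(∪(a ∩ κ^{+(α+1)})) ≥ ∪(a ∩ θ̄)` for every `α < β`. -/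
def cofSet (κ lam θ : Cardinal.{u}) (β : Ordinal.{u}) : Set (Set Ordinal.{u}) :=
  {a | a ∈ Pkl κ lam ∧ CofGe κ θ a κ.ord ∧ ∀ α < β, CofGe κ θ a (plus κ (α + 1)).ord}

section

variable {β : Ordinal.{u}} {K : Set (Set (Set Ordinal.{u}))}

theorem isNormal_iff_max_aleph0 (hκ : κ.IsRegular) (hlam : κ ≤ lam) (hω : ℵ₀ < κ) (hθ2 : 2 ≤ θ)
    (hK : IsIdealOn κ lam K) :
    IsNormal κ lam θ δ K ↔ IsNormal κ lam (max ℵ₀ (thetaBar κ θ)) δ K := by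
  have hF := hK.isFineFilter_ae hκ
  rw [hK.isNormal_iff hκ hlam (two_pos.trans_le hθ2).ne',
    hK.isNormal_iff hκ hlam (aleph0_pos.trans_le (le_max_left _ _)).ne',
    diagClosed_max_aleph0_iff hκ hlam hF (two_le_thetaBar hκ hθ2) hω,
    diagClosed_thetaBar_iff hlam hF]

theorem IsNormal.nabla_Ikl_subset (hK : IsIdealOn κ lam K) (h : IsNormal κ lam t δ K) :
    nabla κ lam t δ (Ikl κ lam) ⊆ K :=
  (nabla_mono hK.Ikl_subset).trans h.symm.subset

theorem aleph0_lt_of_isNormal (hκ : κ.IsRegular) (hlam : κ ≤ lam) (hθ2 : 2 ≤ θ)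
    (hκδ : κ.ord ≤ δ) (hδ : δ ≤ lam.ord) (hK : IsIdealOn κ lam K)
    (hn : IsNormal κ lam θ δ K) : ℵ₀ < κ :=
  ((hK.isNormal_iff hκ hlam (two_pos.trans_le hθ2).ne').1 hn).aleph0_lt hκ hlam
    (hK.isFineFilter_ae hκ) hθ2 hδ hκδ

theorem IsNormal.mk_Ptd_lt (hκ : κ.IsRegular) (hlam : κ ≤ lam) (hθ2 : 2 ≤ θ) (hθκ : θ ≤ κ)
    (hκδ : κ.ord ≤ δ) (hδ : δ ≤ lam.ord) (hK : IsIdealOn κ lam K)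
    (hn : IsNormal κ lam θ δ K) {ξ : Ordinal.{u}} (hξ : ξ < κ.ord) :
    #(Ptd (max ℵ₀ (thetaBar κ θ)) ξ) < Cardinal.lift.{u + 1} κ := by
  have hω := aleph0_lt_of_isNormal hκ hlam hθ2 hκδ hδ hK hn
  have hd := (hK.isNormal_iff hκ hlam (aleph0_pos.trans_le (le_max_left _ _)).ne').1
    ((isNormal_iff_max_aleph0 hκ hlam hω hθ2 hK).1 hn)
  refine (hd.mono le_rfl hκδ).mk_Ptd_lt hκ hlam (hK.isFineFilter_ae hκ)
    (max_le hω.le ((thetaBar_le κ θ).trans hθκ)) (fun h μ hμ => ?_) hξ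
  rcases max_choice ℵ₀ (thetaBar κ θ) with h' | h'
  · exact absurd (h'.symm.trans h) hω.ne
  · exact succ_lt_of_thetaBar_eq (h'.symm.trans h) hμ

/-- If some ideal is `[δ]^{<θ}`-normal, then `NS` is a `[δ]^{<θ}`-normal ideal. -/
theorem isIdealOn_NS_and_isNormal (hκ : κ.IsRegular) (hlam : κ ≤ lam) (hθ2 : 2 ≤ θ) (hθκ : θ ≤ κ)
    (hκδ : κ.ord ≤ δ) (hδ : δ ≤ lam.ord) (hK : IsIdealOn κ lam K)
    (hn : IsNormal κ lam θ δ K) :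
    IsIdealOn κ lam (NS κ lam θ δ) ∧ IsNormal κ lam θ δ (NS κ lam θ δ) := by
  have hω := aleph0_lt_of_isNormal hκ hlam hθ2 hκδ hδ hK hn
  have hσ0 : max ℵ₀ (thetaBar κ θ) ≠ 0 := (aleph0_pos.trans_le (le_max_left _ _)).ne'
  rw [NS_eq_nabla hκ hlam hω hκδ hδ hθ2]
  have hid := isIdealOn_nabla_Ikl (δ := δ) hκ hσ0 hK
    (((isNormal_iff_max_aleph0 hκ hlam hω hθ2 hK).1 hn).nabla_Ikl_subset hK)
  refine ⟨hid, (isNormal_iff_max_aleph0 hκ hlam hω hθ2 hid).2 ?_⟩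
  rw [hid.isNormal_iff_nabla_subset hσ0]
  refine nabla_nabla_Ikl_subset hκ hlam hω (le_max_left _ _) fun μ hμ =>
    two_power_lt_of_mk_Ptd_lt (max_le hω.le ((thetaBar_le κ θ).trans hθκ))
      (fun ξ hξ => hn.mk_Ptd_lt hκ hlam hθ2 hθκ hκδ hδ hK hξ) hμ

/-- `NS` is contained in every `[δ]^{<θ}`-normal ideal. -/
theorem NS_subset_of_isNormal (hκ : κ.IsRegular) (hlam : κ ≤ lam) (hθ2 : 2 ≤ θ)
    (hκδ : κ.ord ≤ δ) (hδ : δ ≤ lam.ord) (hK : IsIdealOn κ lam K)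
    (hn : IsNormal κ lam θ δ K) : NS κ lam θ δ ⊆ K := by
  have hω := aleph0_lt_of_isNormal hκ hlam hθ2 hκδ hδ hK hn
  rw [NS_eq_nabla hκ hlam hω hκδ hδ hθ2]
  exact ((isNormal_iff_max_aleph0 hκ hlam hω hθ2 hK).1 hn).nabla_Ikl_subset hK

theorem IsNormal.eventually_mem_cofSet (hκ : κ.IsRegular) (hlam : κ ≤ lam) (hθ2 : 2 ≤ θ)
    (hθκ : θ ≤ κ) (hδ : δ ≤ lam.ord) (hK : IsIdealOn κ lam K) (hn : IsNormal κ lam θ δ K)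
    (hβ : β.card < κ) (hβδ : δ.card = plus κ β) : ∀ᶠ a in hK.ae hκ, a ∈ cofSet κ lam θ β := by
  have hF := hK.isFineFilter_ae hκ
  have hd := (diagClosed_thetaBar_iff hlam hF).2
    ((hK.isNormal_iff hκ hlam (two_pos.trans_le hθ2).ne').1 hn)
  have ht2 := two_le_thetaBar hκ hθ2
  have htκ := (thetaBar_le κ θ).trans hθκ
  have hlim : thetaBar κ θ = κ → ∀ μ < κ, Order.succ μ < κ := fun h μ hμ =>
    succ_lt_of_thetaBar_eq h hμ
  filter_upwards [hF.mem_Pkl,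
    hd.eventually_cup_le_cof hκ hlam hF ht2 htκ hlim hκ le_rfl
      (ord_le.2 (hβδ ▸ le_plus κ β)) hδ,
    hd.eventually_cup_le_cof_plus hκ hlam hF ht2 htκ hlim le_rfl hβ (ord_le.2 hβδ.ge) hδ]
    with a haP h1 h2
  exact ⟨haP, h1, h2⟩

/-- The cofinality set is in the dual of `NS`, so restricting to it changes nothing. This covers the
case `|β|⁺ = κ` of (3), where both ideals coincide. -/
theorem NS_eq_restrict_self (hκ : κ.IsRegular) (hlam : κ ≤ lam) (hθ2 : 2 ≤ θ) (hθκ : θ ≤ κ)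
    (hδ : δ ≤ lam.ord) (hK : IsIdealOn κ lam K) (hn : IsNormal κ lam θ δ K)
    (hβ : β.card < κ) (hβδ : δ.card = plus κ β) :
    cofSet κ lam θ β ∈ positive κ lam (NS κ lam θ δ) ∧
      NS κ lam θ δ = restrict κ lam (NS κ lam θ δ) (cofSet κ lam θ β) := by
  have hκδ : κ.ord ≤ δ := ord_le.2 (hβδ ▸ le_plus κ β)
  obtain ⟨hN, hNn⟩ := isIdealOn_NS_and_isNormal hκ hlam hθ2 hθκ hκδ hδ hK hn
  have hC := hNn.eventually_mem_cofSet hκ hlam hθ2 hθκ hδ hN hβ hβδ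
  refine ⟨⟨fun a ha => ha.1, hN.notMem_of_eventually_mem hκ hC⟩, ?_⟩
  refine Subset.antisymm (fun B hB => ?_) (hN.restrict_subset hκ Subset.rfl hC)
  exact ⟨hN.subset_Pkl B hB, hN.mem_of_subset _ hB _ inter_subset_left⟩

/-- The parameter `θ'` stands for `2` in (2) and for `|β|⁺` in (3). Only `max ℵ₀ θ̄'` matters for
normality, so both cases supply the `max ℵ₀ |β|⁺`-closure that the descent needs. The restriction is
shown to be `[δ]^{<θ}`-normal, and then minimality of `NS` applies. -/
theorem NS_eq_restrict (hκ : κ.IsRegular) (hlam : κ ≤ lam) (hθ2 : 2 ≤ θ) (hθκ : θ ≤ κ)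
    (hδ : δ ≤ lam.ord) (hK : IsIdealOn κ lam K) (hn : IsNormal κ lam θ δ K)
    (hβκ : Order.succ β.card < κ) (hβδ : δ.card = plus κ β) {θ' : Cardinal.{u}} (hθ'2 : 2 ≤ θ')
    (hθ' : θ' ≤ θ) (hθ'β : max ℵ₀ (thetaBar κ θ') = max ℵ₀ (Order.succ β.card)) :
    cofSet κ lam θ β ∈ positive κ lam (NS κ lam θ' δ) ∧
      NS κ lam θ δ = restrict κ lam (NS κ lam θ' δ) (cofSet κ lam θ β) := by
  have hκδ : κ.ord ≤ δ := ord_le.2 (hβδ ▸ le_plus κ β)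
  have hω := aleph0_lt_of_isNormal hκ hlam hθ2 hκδ hδ hK hn
  have hβ : β.card < κ := (Order.lt_succ _).trans hβκ
  have hpos : ∀ c : Cardinal.{u}, 2 ≤ c → c ≠ 0 := fun c hc => (two_pos.trans_le hc).ne'
  obtain ⟨hN, hNn⟩ := isIdealOn_NS_and_isNormal hκ hlam hθ2 hθκ hκδ hδ hK hn
  have hC := hNn.eventually_mem_cofSet hκ hlam hθ2 hθκ hδ hN hβ hβδ
  have hNn' : IsNormal κ lam θ' δ (NS κ lam θ δ) := by
    rw [hN.isNormal_iff hκ hlam (hpos _ hθ2)] at hNn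
    exact (hN.isNormal_iff hκ hlam (hpos _ hθ'2)).2 (hNn.mono hθ' le_rfl)
  obtain ⟨hN', hN'n⟩ :=
    isIdealOn_NS_and_isNormal hκ hlam hθ'2 (hθ'.trans hθκ) hκδ hδ hN hNn'
  have hsub := NS_subset_of_isNormal hκ hlam hθ'2 hκδ hδ hN hNn'
  have hCpos : cofSet κ lam θ β ∈ positive κ lam (NS κ lam θ' δ) :=
    ⟨fun a ha => ha.1, fun h => hN.notMem_of_eventually_mem hκ hC (hsub h)⟩
  refine ⟨hCpos, Subset.antisymm ?_ (hN.restrict_subset hκ hsub hC)⟩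
  have hR := hN'.restrict hCpos
  have hF := hR.isFineFilter_ae hκ
  have hσ2 : 2 ≤ max ℵ₀ (Order.succ β.card) :=
    (natCast_lt_aleph0 (n := 2)).le.trans (le_max_left _ _)
  have hRC : ∀ᶠ a in hR.ae hκ, a ∈ cofSet κ lam θ β := by
    rw [hN'.eventually_ae_restrict hκ hCpos]
    exact Eventually.of_forall fun a ha => ha
  have hRd : DiagClosed (hR.ae hκ) (max ℵ₀ (Order.succ β.card)) δ := by
    refine hN'.diagClosed_restrict hκ hCpos ?_
    rw [← hN'.isNormal_iff hκ hlam (hpos _ hσ2), ← hθ'β,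
      ← isNormal_iff_max_aleph0 hκ hlam hω hθ'2 hN']
    exact hN'n
  have hbase : DiagClosed (hR.ae hκ) (thetaBar κ θ) κ.ord := by
    -- The bound `|P_θ̄(ξ)| < κ` comes from the given normal ideal `K`; it concerns cardinals only
    -- and so carries over to the restricted ideal.
    refine (hRd.mono le_rfl hκδ).of_cof_of_mk_Ptd_lt hκ hlam hF hσ2 (fun ξ hξ => ?_)
      (hRC.mono fun a ha => ha.2.1)
    exact (mk_le_mk_of_subset (Ptd_mono (le_max_right _ _) le_rfl)).trans_lt
      (hn.mk_Ptd_lt hκ hlam hθ2 hθκ hκδ hδ hK hξ)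
  have hβδ' : (plus κ β).ord ≤ δ := ord_le.2 hβδ.ge
  have hplus : DiagClosed (hR.ae hκ) (thetaBar κ θ) (plus κ β).ord :=
    DiagClosed.plus_of_cof hκ hlam hF le_rfl (max_lt hω hβκ) (hβδ'.trans hδ)
      (hRd.mono le_rfl hβδ') hbase (two_le_thetaBar hκ hθ2) (hRC.mono fun a ha => ha.2.2)
  rw [← hβδ] at hplus
  refine NS_subset_of_isNormal hκ hlam hθ2 hκδ hδ hR ?_
  rw [hR.isNormal_iff hκ hlam (hpos _ hθ2), ← diagClosed_thetaBar_iff hlam hF]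
  exact hRd.of_card hκ hlam hF hσ2 hδ hplus

theorem cofSet_natCast (κ lam θ : Cardinal.{u}) (n : ℕ) :
    cofSet κ lam θ n =
      {a | a ∈ Pkl κ lam ∧ ∀ m : ℕ, m ≤ n → CofGe κ θ a (plus κ m).ord} := by
  ext a
  refine and_congr_right fun _ => ⟨?_, ?_⟩
  · rintro ⟨h0, h⟩ m hm
    cases m with
    | zero => rwa [Nat.cast_zero, plus_zero]
    | succ m =>
      rw [Nat.cast_succ]
      exact h m (Nat.cast_lt.2 hm)
  · intro h
    refine ⟨by simpa [plus_zero] using h 0 (Nat.zero_le n), fun α hα => ?_⟩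
    obtain ⟨m, rfl⟩ := Ordinal.lt_omega0.1 (hα.trans (Ordinal.natCast_lt_omega0 n))
    rw [← Nat.cast_succ]
    exact h (m + 1) (Nat.cast_lt.1 hα)

end

end PkLambda

end

theorem proposition6p2 (κ lam θ : Cardinal.{u}) (δ : Ordinal.{u})
    (hκ : κ.IsRegular) (hlam : κ ≤ lam) (hθ2 : 2 ≤ θ) (hθκ : θ ≤ κ)
    (hδ1 : 1 ≤ δ) (hδ : δ ≤ lam.ord) :
    (∀ J : Set (Set (Set Ordinal.{u})), PkLambda.IsIdealOn κ lam J →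
      ∀ (ρ : Cardinal.{u}) (β : Ordinal.{u}), κ ≤ ρ → 1 ≤ β →
        β < (PkLambda.thetaBar κ θ).ord → δ = (PkLambda.plus ρ β).ord →
        (PkLambda.IsNormal κ lam θ δ J ↔
          PkLambda.IsNormal κ lam (Order.succ β.card) δ J ∧
          PkLambda.IsNormal κ lam θ ρ.ord J ∧
          {a | a ∈ PkLambda.Aset κ lam ρ β ∧
            ∀ α < β, PkLambda.CofGe κ θ a (PkLambda.plus ρ (α + 1)).ord} ∈
              PkLambda.dual κ lam J)) ∧
    ((∃ K, PkLambda.IsIdealOn κ lam K ∧ PkLambda.IsNormal κ lam θ δ K) →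
      (∀ n : ℕ, δ.card = PkLambda.plus κ n →
        ∀ C : Set (Set Ordinal.{u}),
          C = {a | a ∈ PkLambda.Pkl κ lam ∧
            ∀ m : ℕ, m ≤ n → PkLambda.CofGe κ θ a (PkLambda.plus κ m).ord} →
          C ∈ PkLambda.positive κ lam (PkLambda.NS κ lam 2 δ) ∧
          PkLambda.NS κ lam θ δ =
            PkLambda.restrict κ lam (PkLambda.NS κ lam 2 δ) C) ∧
      (∀ β : Ordinal.{u}, Ordinal.omega0 ≤ β → β < θ.ord → δ.card = PkLambda.plus κ β →
        ∀ C : Set (Set Ordinal.{u}),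
          C = {a | a ∈ PkLambda.Pkl κ lam ∧ PkLambda.CofGe κ θ a κ.ord ∧
            ∀ α < β, PkLambda.CofGe κ θ a (PkLambda.plus κ (α + 1)).ord} →
          C ∈ PkLambda.positive κ lam (PkLambda.NS κ lam (Order.succ β.card) δ) ∧
          PkLambda.NS κ lam θ δ =
            PkLambda.restrict κ lam (PkLambda.NS κ lam (Order.succ β.card) δ) C)) := by
  refine ⟨?_, ?_⟩
  · rintro J hJ ρ β hκρ hβ1 hβ rfl
    exact PkLambda.isNormal_plus_iff hκ hlam hθ2 hθκ hJ hκρ hβ1 hβ hδ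
  · rintro ⟨K, hK, hn⟩
    refine ⟨?_, ?_⟩
    · rintro n hcard _ rfl
      rw [← PkLambda.cofSet_natCast]
      have hfin : Order.succ (n : Ordinal.{u}).card < Cardinal.aleph0 :=
        Cardinal.isSuccLimit_aleph0.succ_lt (by
          rw [Ordinal.card_nat]; exact Cardinal.natCast_lt_aleph0)
      refine PkLambda.NS_eq_restrict hκ hlam hθ2 hθκ hδ hK hn (hfin.trans_le hκ.aleph0_le) hcard
        le_rfl hθ2 ?_
      have h2 : (2 : Cardinal.{u}) < κ := hκ.nat_lt 2
      have h2ω : (2 : Cardinal.{u}) < Cardinal.aleph0 := Cardinal.natCast_lt_aleph0 (n := 2)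
      rw [PkLambda.thetaBar_eq_self h2.ne, max_eq_left hfin.le, max_eq_left h2ω.le]
    · rintro β hω hβ hcard _ rfl
      have hβθ : Order.succ β.card ≤ θ := Order.succ_le_of_lt (Cardinal.lt_ord.1 hβ)
      -- If `|β|⁺ = κ`, then `θ = |β|⁺` is forced. The descent is then unavailable, but the two
      -- ideals are literally the same.
      rcases (hβθ.trans hθκ).lt_or_eq with h | h
      · refine PkLambda.NS_eq_restrict hκ hlam hθ2 hθκ hδ hK hn h hcard ?_ hβθ ?_
        · exact ((Cardinal.natCast_lt_aleph0 (n := 2)).le.trans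
            (Ordinal.aleph0_le_card.2 hω)).trans (Order.le_succ _)
        · rw [PkLambda.thetaBar_eq_self h.ne]
      · have hθ : θ = Order.succ β.card := (hθκ.trans_eq h.symm).antisymm hβθ
        rw [← hθ]
        exact PkLambda.NS_eq_restrict_self hκ hlam hθ2 hθκ hδ hK hn
          ((Cardinal.lt_ord.1 hβ).trans_le hθκ) hcard
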